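/- Let $K$ be an algebraically closed field, let $\alpha_1,\alpha_2,\alpha_3>1$, $\alpha_4=3$ and $0<\alpha_{21}<\alpha_1-1$ be integers, and let $S=\langle n_1,n_2,n_3,n_4\rangle$ be the 4-generated pseudo-symmetric numerical semigroup with $$\begin{aligned} n_1&=\alpha_2\alpha_3(\alpha_4-1)+1,\\ n_2&=\alpha_{21}\alpha_3\alpha_4+(\alpha_1-\alpha_{21}-1)(\alpha_3-1)+\alpha_3,\\ n_3&=\alpha_1\alpha_4+(\alpha_1-\alpha_{21}-1)(\alpha_2-1)(\alpha_4-1)-\alpha_4+1,\\ n_4&=\alpha_1\alpha_2(\alpha_3-1)+\alpha_{21}(\alpha_2-1)+\alpha_2,\end{aligned}$$ where $\gcd(n_1,n_2,n_3,n_4)=1$. Assume $n_1<n_2<n_3<n_4$ and $\alpha_2>\alpha_{21}+1$. Let $A=K[X_1,X_2,X_3,X_4]$, let $I_S$ be the kernel of $A\to K[t]$, $X_i\mapsto t^{n_i}$, let $f^*$ denote the least homogeneous summand of $f\in A$, and let $I_S^*=\langle f^*\mid f\in I_S\rangle$, so that $A/I_S^*$ is the tangent cone. Let $s$ and $l$ be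 the smallest non-negative integers with $$s\alpha_1+(2s+2)\alpha_{21}+\alpha_3>(2s+1)\alpha_2+(s+2),\qquad l\alpha_1+(2l+3)\alpha_{21}+\alpha_3>(2l+2)\alpha_2+(l+1).$$ (Then $s\le l<\alpha_3$.) Put $$\begin{aligned} f_1&=X_1^{\alpha_1}-X_3X_4^2, & f_2&=X_2^{\alpha_2}-X_1^{\alpha_{21}}X_4, & f_3&=X_3^{\alpha_3}-X_1^{\alpha_1-\alpha_{21}-1}X_2,\\ f_4&=X_4^3-X_1X_2^{\alpha_2-1}X_3^{\alpha_3-1}, & f_5&=X_1^{\alpha_{21}+1}X_3^{\alpha_3-1}-X_2X_4^2, & f_6&=X_1^{\alpha_1+\alpha_{21}}-X_2^{\alpha_2}X_3X_4,\\ f_7&=X_1^{\alpha_1+2\alpha_{21}}-X_2^{2\alpha_2}X_3,\end{aligned}$$ $$g_i=X_2^{(2i+1)\alpha_2+1}X_4-X_1^{i\alpha_1+(2i+2)\alpha_{21}+1}X_3^{\alpha_3-(i+1)},\qquad h_j=X_2^{(2j+2)\alpha_2+1}-X_1^{j\alpha_1+(2j+3)\alpha_{21}+1}X_3^{\alpha_3-(j+1)}.$$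 1. The least homogeneous summands are $f_1^*=-X_3X_4^2$, $f_2^*=-X_1^{\alpha_{21}}X_4$, $f_3^*=X_3^{\alpha_3}$, $f_4^*=X_4^3$, $f_5^*=-X_2X_4^2$, $f_6^*=-X_2^{\alpha_2}X_3X_4$, $f_7^*=-X_2^{2\alpha_2}X_3$, $g_s^*=X_2^{(2s+1)\alpha_2+1}X_4$, $h_l^*=X_2^{(2l+2)\alpha_2+1}$; for $0\le i<s$, $g_i^*=-X_1^{i\alpha_1+(2i+2)\alpha_{21}+1}X_3^{\alpha_3-(i+1)}$, unless the two terms of $g_i$ have the same degree, that is, $i\alpha_1+(2i+2)\alpha_{21}+\alpha_3=(2i+1)\alpha_2+(i+2)$, and then $g_i^*=g_i$; for $s\le j<l$, $h_j^*=-X_1^{j\alpha_1+(2j+3)\alpha_{21}+1}X_3^{\alpha_3-(j+1)}$, unless the two terms of $h_j$ have the same degree, that is, $j\alpha_1+(2j+3)\alpha_{21}+\alpha_3=(2j+2)\alpha_2+(j+1)$, and then $h_j^*=h_j$. 2. The set $G^*=\{f_1^*,\dots,f_7^*,g_0^*,\dots,g_s^*,h_s^*,\dots,h_l^*\}$ generates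 $I_S^*$, and it is a standard basis of $I_S^*$ with respect to every local degree ordering (a total ordering of the monomials, compatible with multiplication, in which a monomial of smaller degree is larger) for which $X_1^{i\alpha_1+(2i+2)\alpha_{21}+1}X_3^{\alpha_3-(i+1)}>X_2^{(2i+1)\alpha_2+1}X_4$ for all $0\le i<s$ (which is automatic when these two monomials have different degrees); that is, $G^*$ is a finite subset of $I_S^*$ and the leading monomials of its elements generate the ideal generated by the leading monomials of all nonzero elements of $I_S^*$. 3. $X_1$ divides $f_2^*$, and the tangent cone $A/I_S^*$ is not Cohen–Macaulay. -/

import Mathlib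

open MvPolynomial

/-! ### Monomial curves, least homogeneous forms and the tangent cone -/

/-- The defining ideal `I_S` of the monomial curve with parametrization `X_i = t ^ n_i`: the kernel
of `K[X_1, …, X_m] → K[S] ⊆ K[t]`, `X_i ↦ t ^ n_i`. -/
noncomputable def toricIdeal (K : Type*) [Field K] {m : ℕ} (n : Fin m → ℕ) :
    Ideal (MvPolynomial (Fin m) K) :=
  RingHom.ker (aeval (fun i => (Polynomial.X : Polynomial K) ^ n i) :
    MvPolynomial (Fin m) K →ₐ[K] Polynomial K)

/-- The least homogeneous summand `f^*` of `f` (for the standard grading); `0^* = 0`. -/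
noncomputable def leastForm {K : Type*} [Field K] {m : ℕ} (f : MvPolynomial (Fin m) K) :
    MvPolynomial (Fin m) K :=
  homogeneousComponent (sInf {d : ℕ | homogeneousComponent d f ≠ 0}) f

/-- The ideal `I^*` generated by the least homogeneous summands of the elements of `I`. -/
noncomputable def tangentConeIdeal {K : Type*} [Field K] {m : ℕ}
    (I : Ideal (MvPolynomial (Fin m) K)) : Ideal (MvPolynomial (Fin m) K) :=
  Ideal.span (leastForm '' (I : Set (MvPolynomial (Fin m) K)))

/-! ### Standard bases with respect to local degree orderings -/

/-- A local degree ordering on the monomials in `m` variables: a total ordering, compatible with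
multiplication, in which a monomial of smaller total degree is larger. -/
structure LocalDegreeOrder (m : ℕ) where
  /-- `lt a b` means `X ^ a < X ^ b`. -/
  lt : (Fin m →₀ ℕ) → (Fin m →₀ ℕ) → Prop
  irrefl : ∀ a, ¬ lt a a
  trans : ∀ a b c, lt a b → lt b c → lt a c
  total : ∀ a b, lt a b ∨ a = b ∨ lt b a
  add_right : ∀ a b c, lt a b → lt (a + c) (b + c)
  lt_of_degree_lt : ∀ a b, b.degree < a.degree → lt a b

/-- `a` is the exponent of the leading (that is, largest) monomial of `f`. -/
def LocalDegreeOrder.IsLeadingExponent {K : Type*} [Field K] {m : ℕ} (o : LocalDegreeOrder m)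
    (f : MvPolynomial (Fin m) K) (a : Fin m →₀ ℕ) : Prop :=
  a ∈ f.support ∧ ∀ b ∈ f.support, b ≠ a → o.lt b a

/-- The ideal generated by the leading monomials of the nonzero elements of `G`. -/
noncomputable def LocalDegreeOrder.leadingIdeal {K : Type*} [Field K] {m : ℕ}
    (o : LocalDegreeOrder m) (G : Set (MvPolynomial (Fin m) K)) :
    Ideal (MvPolynomial (Fin m) K) :=
  Ideal.span {u | ∃ f ∈ G, ∃ a, o.IsLeadingExponent f a ∧ u = monomial a 1}

/-- `G` is a standard basis of the ideal `I` with respect to the ordering `o`. -/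
def LocalDegreeOrder.IsStandardBasis {K : Type*} [Field K] {m : ℕ} (o : LocalDegreeOrder m)
    (G : Set (MvPolynomial (Fin m) K)) (I : Ideal (MvPolynomial (Fin m) K)) : Prop :=
  G.Finite ∧ G ⊆ (I : Set (MvPolynomial (Fin m) K)) ∧
    o.leadingIdeal G = o.leadingIdeal (I : Set (MvPolynomial (Fin m) K))

/-! ### Cohen–Macaulay rings -/

/-- A Noetherian local ring is Cohen–Macaulay if its maximal ideal contains a regular sequence whose
length is the Krull dimension. -/
def IsCohenMacaulayLocal (R : Type*) [CommRing R] [IsLocalRing R] : Prop :=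
  IsNoetherianRing R ∧ ∃ rs : List R, (∀ r ∈ rs, r ∈ IsLocalRing.maximalIdeal R) ∧
    RingTheory.Sequence.IsRegular R rs ∧ (rs.length : WithBot ℕ∞) = ringKrullDim R

/-- A Noetherian ring is Cohen–Macaulay if its localizations at all prime ideals are. -/
def IsCohenMacaulayRing (R : Type*) [CommRing R] : Prop :=
  IsNoetherianRing R ∧ ∀ (p : Ideal R) [p.IsPrime], IsCohenMacaulayLocal (Localization.AtPrime p)

/-! ### 4-generated pseudo-symmetric monomial curves -/

/-- The parameters of a 4-generated pseudo-symmetric semigroup. -/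
structure PSParams where
  α₁ : ℕ
  α₂ : ℕ
  α₃ : ℕ
  α₄ : ℕ
  α₂₁ : ℕ

namespace PSParams

/-- The constraints `α_i > 1` and `0 < α₂₁ < α₁ - 1`. With them, no subtraction of natural numbers
below truncates (the exponents of `X_3` in `g i`, `h j` are used for `i, j < α₃` only). -/
def Valid (p : PSParams) : Prop :=
  1 < p.α₁ ∧ 1 < p.α₂ ∧ 1 < p.α₃ ∧ 1 < p.α₄ ∧ 0 < p.α₂₁ ∧ p.α₂₁ < p.α₁ - 1

/-- The generators `n_1, n_2, n_3, n_4` of the semigroup. -/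
def n (p : PSParams) : Fin 4 → ℕ :=
  ![p.α₂ * p.α₃ * (p.α₄ - 1) + 1,
    p.α₂₁ * p.α₃ * p.α₄ + (p.α₁ - p.α₂₁ - 1) * (p.α₃ - 1) + p.α₃,
    p.α₁ * p.α₄ + (p.α₁ - p.α₂₁ - 1) * (p.α₂ - 1) * (p.α₄ - 1) - p.α₄ + 1,
    p.α₁ * p.α₂ * (p.α₃ - 1) + p.α₂₁ * (p.α₂ - 1) + p.α₂]

variable (K : Type*) [Field K] (p : PSParams)

/-! The variables `X_1, X_2, X_3, X_4` are `X 0, X 1, X 2, X 3`. -/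

noncomputable def f₁ : MvPolynomial (Fin 4) K := X 0 ^ p.α₁ - X 2 * X 3 ^ (p.α₄ - 1)

noncomputable def f₂ : MvPolynomial (Fin 4) K := X 1 ^ p.α₂ - X 0 ^ p.α₂₁ * X 3

noncomputable def f₃ : MvPolynomial (Fin 4) K := X 2 ^ p.α₃ - X 0 ^ (p.α₁ - p.α₂₁ - 1) * X 1

noncomputable def f₄ : MvPolynomial (Fin 4) K :=
  X 3 ^ p.α₄ - X 0 * X 1 ^ (p.α₂ - 1) * X 2 ^ (p.α₃ - 1)

noncomputable def f₅ : MvPolynomial (Fin 4) K :=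
  X 0 ^ (p.α₂₁ + 1) * X 2 ^ (p.α₃ - 1) - X 1 * X 3 ^ (p.α₄ - 1)

noncomputable def f₆ : MvPolynomial (Fin 4) K :=
  X 0 ^ (p.α₁ + p.α₂₁) - X 1 ^ p.α₂ * X 2 * X 3

noncomputable def f₇ : MvPolynomial (Fin 4) K :=
  X 0 ^ (p.α₁ + 2 * p.α₂₁) - X 1 ^ (2 * p.α₂) * X 2

noncomputable def g (i : ℕ) : MvPolynomial (Fin 4) K :=
  X 1 ^ ((2 * i + 1) * p.α₂ + 1) * X 3
    - X 0 ^ (i * p.α₁ + (2 * i + 2) * p.α₂₁ + 1) * X 2 ^ (p.α₃ - (i + 1))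

noncomputable def h (j : ℕ) : MvPolynomial (Fin 4) K :=
  X 1 ^ ((2 * j + 2) * p.α₂ + 1)
    - X 0 ^ (j * p.α₁ + (2 * j + 3) * p.α₂₁ + 1) * X 2 ^ (p.α₃ - (j + 1))

/-- `G = {f₁, …, f₇, g 0, …, g s, h s, …, h l}`. -/
def basisSet (s l : ℕ) : Set (MvPolynomial (Fin 4) K) :=
  {p.f₁ K, p.f₂ K, p.f₃ K, p.f₄ K, p.f₅ K, p.f₆ K, p.f₇ K}
    ∪ {q | ∃ i ≤ s, q = p.g K i} ∪ {q | ∃ j, s ≤ j ∧ j ≤ l ∧ q = p.h K j}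

/-- `s` is the smallest natural number with
`s α₁ + (2s+2) α₂₁ + α₃ > (2s+1) α₂ + (s+2)`. -/
def IsS (p : PSParams) (s : ℕ) : Prop :=
  IsLeast {s : ℕ | s * p.α₁ + (2 * s + 2) * p.α₂₁ + p.α₃ > (2 * s + 1) * p.α₂ + (s + 2)} s

/-- `l` is the smallest natural number with
`l α₁ + (2l+3) α₂₁ + α₃ > (2l+2) α₂ + (l+1)`. -/
def IsL (p : PSParams) (l : ℕ) : Prop :=
  IsLeast {l : ℕ | l * p.α₁ + (2 * l + 3) * p.α₂₁ + p.α₃ > (2 * l + 2) * p.α₂ + (l + 1)} l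

/-- The ordering `o` ranks the monomial `X_1 ^ (iα₁+(2i+2)α₂₁+1) * X_3 ^ (α₃-(i+1))` of `g i` above
its monomial `X_2 ^ ((2i+1)α₂+1) * X_4`. -/
def LeadsG (p : PSParams) (o : LocalDegreeOrder 4) (i : ℕ) : Prop :=
  o.lt (Finsupp.single 1 ((2 * i + 1) * p.α₂ + 1) + Finsupp.single 3 1)
    (Finsupp.single 0 (i * p.α₁ + (2 * i + 2) * p.α₂₁ + 1) + Finsupp.single 2 (p.α₃ - (i + 1)))

end PSParams

/-! ### Leading exponents -/

namespace LocalDegreeOrder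

variable {K : Type*} [Field K] {m : ℕ}

/-! The toric ideal is spanned by binomials, so everything reduces to pairs of monomials of equal
weight `∑ u i * n i`. Call a monomial standard if no leading monomial of `G` divides it. If two
distinct monomials of equal weight are never both standard, then the least forms of `G` are a
standard basis (`isStandardBasis_leastForm`): a standard leading monomial of an element of the ideal
could be compared with smaller monomials of its weight, and these can always be rewritten to still
smaller ones, although there are only finitely many.

To check this condition, let `z` be the difference of two exponent vectors of equal weight. As `n 0`
and `n 1` are coprime, `z` is an integral combination of the exponent vectors of `f₁`, `f₂`, `f₃`
(`exists_lattice_coordinates`). A case distinction on its coordinates shows that `z` or `-z`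
dominates a leading exponent of `G` in the entries where that exponent is positive
(`dominatesLead_or`); since `z ≤ u` and `-z ≤ v` for `z = u - v`, that leading monomial divides one
of the two monomials. The only freedom left to the ordering is the index `t` at which the leading
term of `h j` changes (`exists_switch`).

Homogeneous standard bases generate (`IsStandardBasis.span_eq`), and one admissible ordering,
`degLex`, is enough for this. The least forms then show that the class of `X 3 ^ 2` is nonzero at
the origin and is killed by a power of every variable, while `X 0` is not nilpotent there: depth
zero in positive dimension. -/

lemma asymm (o : LocalDegreeOrder m) {a b : Fin m →₀ ℕ} (h : o.lt a b) : ¬ o.lt b a :=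
  fun h' => o.irrefl a (o.trans a b a h h')

lemma degree_le (o : LocalDegreeOrder m) {a b : Fin m →₀ ℕ} (h : o.lt a b) :
    b.degree ≤ a.degree := by
  by_contra! hlt
  exact o.asymm h (o.lt_of_degree_lt _ _ hlt)

lemma exists_minimal (o : LocalDegreeOrder m) {T : Set (Fin m →₀ ℕ)} (hT : T.Finite)
    (hne : T.Nonempty) : ∃ a ∈ T, ∀ b ∈ T, ¬ o.lt b a := by
  have : IsStrictOrder (Fin m →₀ ℕ) o.lt := { irrefl := o.irrefl, trans := o.trans }
  obtain ⟨a, ha⟩ := (hT.wellFoundedOn (r := o.lt)).has_min (Set.univ)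
    ⟨⟨_, hne.some_mem⟩, trivial⟩
  exact ⟨a, a.2, fun b hb => ha.2 ⟨b, hb⟩ trivial⟩

lemma exists_maximal (o : LocalDegreeOrder m) {T : Set (Fin m →₀ ℕ)} (hT : T.Finite)
    (hne : T.Nonempty) : ∃ a ∈ T, ∀ b ∈ T, b ≠ a → o.lt b a := by
  have : IsStrictOrder (Fin m →₀ ℕ) (fun a b => o.lt b a) :=
    { irrefl := o.irrefl, trans := fun a b c h h' => o.trans c b a h' h }
  obtain ⟨a, ha⟩ := (hT.wellFoundedOn (r := fun a b => o.lt b a)).has_min (Set.univ)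
    ⟨⟨_, hne.some_mem⟩, trivial⟩
  exact ⟨a, a.2, fun b hb hba =>
    ((o.total b a).resolve_right (not_or.2 ⟨hba, ha.2 ⟨b, hb⟩ trivial⟩))⟩

lemma exists_isLeadingExponent (o : LocalDegreeOrder m) {f : MvPolynomial (Fin m) K}
    (hf : f ≠ 0) : ∃ a, o.IsLeadingExponent f a :=
  o.exists_maximal f.support.finite_toSet (support_nonempty.2 hf)

lemma IsLeadingExponent.degree_le {o : LocalDegreeOrder m} {f : MvPolynomial (Fin m) K}
    {a b : Fin m →₀ ℕ} (h : o.IsLeadingExponent f a) (hb : b ∈ f.support) :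
    a.degree ≤ b.degree := by
  by_cases hba : b = a
  · rw [hba]
  · exact o.degree_le (h.2 b hb hba)

/-- The monomials of a leading ideal are the multiples of the leading monomials. -/
lemma monomial_mem_leadingIdeal (o : LocalDegreeOrder m) {G : Set (MvPolynomial (Fin m) K)}
    {a : Fin m →₀ ℕ} :
    monomial a (1 : K) ∈ o.leadingIdeal G ↔ ∃ f ∈ G, ∃ b, o.IsLeadingExponent f b ∧ b ≤ a := by
  classical
  have h : {u : MvPolynomial (Fin m) K | ∃ f ∈ G, ∃ a, o.IsLeadingExponent f a ∧
      u = monomial a 1} = (fun s => monomial s (1 : K)) ''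
        {b | ∃ f ∈ G, o.IsLeadingExponent f b} := by
    ext u
    constructor
    · rintro ⟨f, hf, b, hb, rfl⟩
      exact ⟨b, ⟨f, hf, hb⟩, rfl⟩
    · rintro ⟨b, ⟨f, hf, hb⟩, rfl⟩
      exact ⟨f, hf, b, hb, rfl⟩
  rw [leadingIdeal, h, mem_ideal_span_monomial_image, support_monomial, if_neg one_ne_zero]
  constructor
  · intro H
    obtain ⟨b, ⟨f, hf, hb⟩, h⟩ := H a (Finset.mem_singleton_self a)
    exact ⟨f, hf, b, hb, h⟩
  · rintro ⟨f, hf, b, hb, h⟩ c hc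
    rw [Finset.mem_singleton.1 hc]
    exact ⟨b, ⟨f, hf, hb⟩, h⟩

/-- A standard basis consisting of homogeneous polynomials generates. -/
theorem IsStandardBasis.span_eq {o : LocalDegreeOrder m} {G : Set (MvPolynomial (Fin m) K)}
    {I : Ideal (MvPolynomial (Fin m) K)} (h : o.IsStandardBasis G I)
    (hG : ∀ f ∈ G, ∃ d, f.IsHomogeneous d) : Ideal.span G = I := by
  classical
  have hle : Ideal.span G ≤ I := Ideal.span_le.2 h.2.1
  -- `N` is the space spanned by the standard monomials; every polynomial has a normal form in it
  -- modulo `Ideal.span G`.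
  set N := restrictSupport K {a : Fin m →₀ ℕ | monomial a (1 : K) ∉ o.leadingIdeal G} with hN
  set M := (Ideal.span G).restrictScalars K ⊔ N with hM
  have key : ∀ a : Fin m →₀ ℕ, monomial a (1 : K) ∈ M := by
    intro a
    by_contra ha
    -- A local ordering need not be well-founded, but homogeneity of `G` keeps the reduction among
    -- the finitely many monomials of one degree.
    obtain ⟨b, ⟨hb, hbd⟩, hmin⟩ := o.exists_minimal
      (T := {b | monomial b (1 : K) ∉ M ∧ b.degree = a.degree})
      ((Finsupp.finite_of_degree_eq a.degree).subset fun b hb => hb.2) ⟨a, ha, rfl⟩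
    by_cases hbL : monomial b (1 : K) ∈ o.leadingIdeal G
    · obtain ⟨g, hg, c, hc, hcb⟩ := o.monomial_mem_leadingIdeal.1 hbL
      obtain ⟨d, hd⟩ := hG g hg
      have hdeg : ∀ w ∈ g.support, w.degree = d := fun w hw => by
        rw [Finsupp.degree_eq_weight_one]
        exact hd (mem_support_iff.1 hw)
      set q := monomial (b - c) (1 : K) * g with hq
      have hqb : coeff b q = coeff c g := by
        rw [hq, coeff_monomial_mul', if_pos tsub_le_self, one_mul, tsub_tsub_cancel_of_le hcb]
      have hqM : q ∈ M := (le_sup_left : _ ≤ M) (Ideal.mul_mem_left _ _ (Ideal.subset_span hg))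
      have hbq : b ∈ q.support := by
        rw [mem_support_iff, hqb]
        exact mem_support_iff.1 hc.1
      have hrest : ∀ v ∈ q.support.erase b, monomial v (coeff v q) ∈ M := by
        intro v hv
        obtain ⟨hvb, hv⟩ := Finset.mem_erase.1 hv
        rw [mem_support_iff, hq, coeff_monomial_mul', ite_ne_right_iff, one_mul] at hv
        obtain ⟨hle, hv⟩ := hv
        have hw := mem_support_iff.2 hv
        have hv' : v = (v - (b - c)) + (b - c) := (tsub_add_cancel_of_le hle).symm
        have hb' : b = c + (b - c) := (add_tsub_cancel_of_le hcb).symm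
        have hne : v - (b - c) ≠ c := fun h => hvb (by rw [hv', h, ← hb'])
        have hlt : o.lt v b := by
          rw [hv']
          nth_rw 3 [hb']
          exact o.add_right _ _ _ (hc.2 _ hw hne)
        have hvd : v.degree = a.degree := by
          rw [hv', ← hbd]
          nth_rw 3 [hb']
          rw [map_add, map_add, hdeg _ hw, hdeg _ hc.1]
        have hvM : monomial v (1 : K) ∈ M := by
          by_contra hvM
          exact hmin v ⟨hvM, hvd⟩ hlt
        simpa [smul_monomial] using M.smul_mem (coeff v q) hvM
      have hsum := q.as_sum
      rw [← Finset.add_sum_erase _ _ hbq] at hsum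
      have hmem : monomial b (coeff b q) ∈ M := by
        rw [eq_sub_of_add_eq hsum.symm]
        exact M.sub_mem hqM (Submodule.sum_mem _ hrest)
      have := M.smul_mem (coeff b q)⁻¹ hmem
      rw [smul_monomial, smul_eq_mul, inv_mul_cancel₀ (mem_support_iff.1 hbq)] at this
      exact hb this
    · exact hb ((le_sup_right : _ ≤ M) ((monomial_mem_restrictSupport K).2 (Or.inl hbL)))
  refine le_antisymm hle fun F hF => ?_
  have hF' : F ∈ M := by
    rw [F.as_sum]
    refine Submodule.sum_mem _ fun a _ => ?_
    simpa [smul_monomial] using M.smul_mem (coeff a F) (key a)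
  -- The normal form `r` lies in `I`, so a leading monomial of it would lie in the leading ideal,
  -- which `N` avoids.
  obtain ⟨x, hx, r, hr, rfl⟩ := Submodule.mem_sup.1 hF'
  have hrI : r ∈ I := by simpa using I.sub_mem hF (hle hx)
  suffices r = 0 by simpa [this] using hx
  by_contra hr0
  obtain ⟨a, ha⟩ := o.exists_isLeadingExponent hr0
  refine (mem_restrictSupport_iff K).1 hr ha.1 ?_
  rw [h.2.2, monomial_mem_leadingIdeal]
  exact ⟨r, hrI, a, ha, le_rfl⟩

/-- The ordering by degree (smaller degrees first) and then lexicographic, with the first variable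
the largest. -/
def degLex (m : ℕ) : LocalDegreeOrder m where
  lt a b := b.degree < a.degree ∨ b.degree = a.degree ∧ toLex a < toLex b
  irrefl a h := by simp at h
  trans a b c h h' := by
    rcases h with h | ⟨h, k⟩ <;> rcases h' with h' | ⟨h', k'⟩
    · exact Or.inl (h'.trans h)
    · exact Or.inl (h' ▸ h)
    · exact Or.inl (h ▸ h')
    · exact Or.inr ⟨h'.trans h, k.trans k'⟩
  total a b := by
    rcases lt_trichotomy a.degree b.degree with h | h | h
    · exact Or.inr (Or.inr (Or.inl h))
    · rcases lt_trichotomy (toLex a) (toLex b) with k | k | k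
      · exact Or.inl (Or.inr ⟨h.symm, k⟩)
      · exact Or.inr (Or.inl (toLex.injective k))
      · exact Or.inr (Or.inr (Or.inr ⟨h, k⟩))
    · exact Or.inl (Or.inl h)
  add_right a b c h := by
    rw [map_add, map_add]
    rcases h with h | ⟨h, k⟩
    · exact Or.inl (by omega)
    · exact Or.inr ⟨by omega, by rw [toLex_add, toLex_add]; exact add_lt_add_left k _⟩
  lt_of_degree_lt a b h := Or.inl h

end LocalDegreeOrder

/-! ### Least forms -/

section TangentCone

variable {K : Type*} [Field K] {m : ℕ}

lemma leastForm_isHomogeneous (f : MvPolynomial (Fin m) K) : ∃ d, (leastForm f).IsHomogeneous d :=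
  ⟨_, homogeneousComponent_isHomogeneous _ _⟩

lemma leastForm_eq_homogeneousComponent {f : MvPolynomial (Fin m) K} {a : Fin m →₀ ℕ}
    (ha : a ∈ f.support) (hmin : ∀ b ∈ f.support, a.degree ≤ b.degree) :
    leastForm f = homogeneousComponent a.degree f := by
  rw [leastForm]
  congr
  refine IsLeast.csInf_eq ⟨fun h => ?_, fun d hd => ?_⟩
  · have := congrArg (coeff a) h
    rw [coeff_homogeneousComponent, if_pos rfl, coeff_zero] at this
    exact mem_support_iff.1 ha this
  · by_contra! hlt
    exact hd (homogeneousComponent_eq_zero' _ _ fun b hb h => by have := hmin b hb; omega)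

@[simp] lemma leastForm_zero : leastForm (0 : MvPolynomial (Fin m) K) = 0 := by
  rw [leastForm, map_zero]

lemma leastForm_neg (f : MvPolynomial (Fin m) K) : leastForm (-f) = -leastForm f := by
  simp [leastForm]

lemma exists_min_degree {f : MvPolynomial (Fin m) K} (hf : f ≠ 0) :
    ∃ a ∈ f.support, ∀ b ∈ f.support, a.degree ≤ b.degree :=
  f.support.exists_min_image _ (support_nonempty.2 hf)

/-- The ordering compares degrees first, so the leading monomial already sits in the least
homogeneous summand. -/
lemma LocalDegreeOrder.IsLeadingExponent.leastForm {o : LocalDegreeOrder m}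
    {f : MvPolynomial (Fin m) K} {a : Fin m →₀ ℕ} (h : o.IsLeadingExponent f a) :
    o.IsLeadingExponent (leastForm f) a := by
  rw [leastForm_eq_homogeneousComponent h.1 fun b => h.degree_le]
  refine ⟨?_, fun b hb hba => h.2 b ?_ hba⟩
  · rw [mem_support_iff, coeff_homogeneousComponent, if_pos rfl]
    exact mem_support_iff.1 h.1
  · rw [mem_support_iff, coeff_homogeneousComponent, ite_ne_right_iff] at hb
    exact mem_support_iff.2 hb.2

/-- Every homogeneous component of an element of `I^*` is the lowest part of an element of `I`. -/
lemma exists_initial_of_mem_tangentConeIdeal {I : Ideal (MvPolynomial (Fin m) K)}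
    {F : MvPolynomial (Fin m) K} (hF : F ∈ tangentConeIdeal I) (d : ℕ) :
    ∃ f ∈ I, (∀ v, v.degree < d → coeff v f = 0) ∧ ∀ v, v.degree = d → coeff v f = coeff v F := by
  classical
  induction hF using Submodule.span_induction generalizing d with
  | mem F hF =>
    obtain ⟨f, hf, rfl⟩ := hF
    by_cases h0 : f = 0
    · exact ⟨0, I.zero_mem, by simp, by simp [h0]⟩
    · obtain ⟨a, ha, hmin⟩ := exists_min_degree h0
      rw [leastForm_eq_homogeneousComponent ha hmin]
      by_cases hd : a.degree = d
      · subst hd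
        refine ⟨f, hf, fun v hv => ?_, fun v hv => by rw [coeff_homogeneousComponent, if_pos hv]⟩
        by_contra h
        exact absurd (hmin v (mem_support_iff.2 h)) (by omega)
      · exact ⟨0, I.zero_mem, by simp, fun v hv => by
          rw [coeff_homogeneousComponent, if_neg (by omega), coeff_zero]⟩
  | zero => exact ⟨0, I.zero_mem, by simp, by simp⟩
  | add F G _ _ hF hG =>
    obtain ⟨f, hf, hf0, hf1⟩ := hF d
    obtain ⟨g, hg, hg0, hg1⟩ := hG d
    exact ⟨f + g, I.add_mem hf hg, fun v hv => by rw [coeff_add, hf0 v hv, hg0 v hv, add_zero],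
      fun v hv => by rw [coeff_add, coeff_add, hf1 v hv, hg1 v hv]⟩
  | smul r F _ hF =>
    rw [smul_eq_mul]
    induction r using MvPolynomial.induction_on generalizing d with
    | C c =>
      obtain ⟨f, hf, hf0, hf1⟩ := hF d
      exact ⟨C c * f, I.mul_mem_left _ hf,
        fun v hv => by rw [coeff_C_mul, hf0 v hv, mul_zero],
        fun v hv => by rw [coeff_C_mul, coeff_C_mul, hf1 v hv]⟩
    | add p q hp hq =>
      obtain ⟨f, hf, hf0, hf1⟩ := hp d
      obtain ⟨g, hg, hg0, hg1⟩ := hq d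
      exact ⟨f + g, I.add_mem hf hg, fun v hv => by rw [coeff_add, hf0 v hv, hg0 v hv, add_zero],
        fun v hv => by rw [add_mul, coeff_add, coeff_add, hf1 v hv, hg1 v hv]⟩
    -- Multiplication by a variable shifts degrees by one, so degree `d + 1` uses the hypothesis at
    -- `d`; this is why `d` is generalized.
    | mul_X p i hp =>
      have hdeg : ∀ v : Fin m →₀ ℕ, i ∈ v.support →
          (v - Finsupp.single i 1).degree + 1 = v.degree := by
        intro v hv
        have h1 : Finsupp.single i 1 ≤ v :=
          Finsupp.single_le_iff.2 (Nat.one_le_iff_ne_zero.2 (Finsupp.mem_support_iff.1 hv))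
        conv_rhs => rw [← tsub_add_cancel_of_le h1, map_add, Finsupp.degree_single]
      have hX : p * X i * F = p * F * X i := by ring
      rw [hX]
      rcases d with _ | d
      · refine ⟨0, I.zero_mem, by simp, fun v hv => ?_⟩
        rw [coeff_mul_X', coeff_zero, if_neg]
        intro h
        have := hdeg v h
        omega
      · obtain ⟨f, hf, hf0, hf1⟩ := hp d
        refine ⟨f * X i, I.mul_mem_right _ hf, fun v hv => ?_, fun v hv => ?_⟩
        · rw [coeff_mul_X']
          split_ifs with h
          · have := hdeg v h
            exact hf0 _ (by omega)
          · rfl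
        · rw [coeff_mul_X', coeff_mul_X']
          split_ifs with h
          · have := hdeg v h
            exact hf1 _ (by omega)
          · rfl

lemma LocalDegreeOrder.exists_isLeadingExponent_of_mem_tangentConeIdeal (o : LocalDegreeOrder m)
    {I : Ideal (MvPolynomial (Fin m) K)} {F : MvPolynomial (Fin m) K} {a : Fin m →₀ ℕ}
    (hF : F ∈ tangentConeIdeal I) (ha : o.IsLeadingExponent F a) :
    ∃ f ∈ I, o.IsLeadingExponent f a := by
  obtain ⟨f, hf, hf0, hf1⟩ := exists_initial_of_mem_tangentConeIdeal hF a.degree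
  refine ⟨f, hf, ?_, fun b hb hba => ?_⟩
  · rw [mem_support_iff, hf1 a rfl]
    exact mem_support_iff.1 ha.1
  · rw [mem_support_iff] at hb
    rcases lt_trichotomy b.degree a.degree with h | h | h
    · exact absurd (hf0 b h) hb
    · exact ha.2 b (by rwa [mem_support_iff, ← hf1 b h]) hba
    · exact o.lt_of_degree_lt _ _ h

/-! ### Toric ideals -/

lemma aeval_X_pow_monomial (n : Fin m → ℕ) (u : Fin m →₀ ℕ) (c : K) :
    aeval (fun i => (Polynomial.X : Polynomial K) ^ n i) (monomial u c) =
      Polynomial.monomial (Finsupp.weight n u) c := by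
  rw [aeval_monomial, Finsupp.weight_apply, Finsupp.prod, Finsupp.sum,
    ← Polynomial.C_mul_X_pow_eq_monomial, ← Finset.prod_pow_eq_pow_sum]
  congr 1
  exact Finset.prod_congr rfl fun i _ => by rw [← pow_mul, smul_eq_mul, mul_comm]

lemma monomial_sub_monomial_mem_toricIdeal {n : Fin m → ℕ} {u v : Fin m →₀ ℕ}
    (h : Finsupp.weight n u = Finsupp.weight n v) :
    monomial u (1 : K) - monomial v 1 ∈ toricIdeal K n := by
  rw [toricIdeal, RingHom.mem_ker, map_sub]
  erw [aeval_X_pow_monomial, aeval_X_pow_monomial]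
  rw [h, sub_self]

/-- The coefficient of `t ^ weight u` in the image of `f` is the sum of the coefficients of all
monomials of that weight, so a single one cannot cancel. -/
lemma exists_weight_eq_of_mem_toricIdeal {n : Fin m → ℕ} {f : MvPolynomial (Fin m) K}
    (hf : f ∈ toricIdeal K n) {u : Fin m →₀ ℕ} (hu : u ∈ f.support) :
    ∃ v ∈ f.support, v ≠ u ∧ Finsupp.weight n v = Finsupp.weight n u := by
  by_contra! H
  have h0 : aeval (fun i => (Polynomial.X : Polynomial K) ^ n i) f = 0 := hf
  rw [f.as_sum, map_sum] at h0
  have h1 := congrArg (fun q => Polynomial.coeff q (Finsupp.weight n u)) h0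
  simp only [aeval_X_pow_monomial, Polynomial.finsetSum_coeff, Polynomial.coeff_monomial,
    Polynomial.coeff_zero] at h1
  rw [Finset.sum_eq_single u (fun v hv hvu => if_neg (H v hv hvu)) (fun h => absurd hu h),
    if_pos rfl] at h1
  exact mem_support_iff.1 hu h1

/-- A finite subset of a toric ideal is a standard basis, on the level of tangent cones,
as soon as no two monomials of the same weight avoid its leading monomials. -/
theorem LocalDegreeOrder.isStandardBasis_leastForm (o : LocalDegreeOrder m)
    {n : Fin m → ℕ} (hn : ∀ i, n i ≠ 0) {G : Set (MvPolynomial (Fin m) K)} (hfin : G.Finite)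
    (hG : G ⊆ (toricIdeal K n : Set (MvPolynomial (Fin m) K)))
    (hinj : ∀ u v : Fin m →₀ ℕ, u ≠ v → Finsupp.weight n u = Finsupp.weight n v →
      ∃ f ∈ G, ∃ w, o.IsLeadingExponent f w ∧ (w ≤ u ∨ w ≤ v)) :
    o.IsStandardBasis (_root_.leastForm '' G) (tangentConeIdeal (toricIdeal K n)) := by
  classical
  have hsub : _root_.leastForm '' G ⊆ (tangentConeIdeal (toricIdeal K n) : Set _) := by
    rintro _ ⟨f, hf, rfl⟩
    exact Ideal.subset_span ⟨f, hG hf, rfl⟩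
  refine ⟨hfin.image _, hsub, le_antisymm ?_ ?_⟩
  · refine Ideal.span_mono ?_
    rintro _ ⟨f, hf, a, ha, rfl⟩
    exact ⟨f, hsub hf, a, ha, rfl⟩
  refine Ideal.span_le.2 ?_
  rintro _ ⟨F, hF, u, hu, rfl⟩
  obtain ⟨f, hf, huf⟩ := o.exists_isLeadingExponent_of_mem_tangentConeIdeal hF hu
  obtain ⟨v, hv, hvu, hw⟩ := exists_weight_eq_of_mem_toricIdeal hf huf.1
  rw [SetLike.mem_coe, monomial_mem_leadingIdeal]
  by_contra! hcon
  have hstd : ∀ f ∈ G, ∀ w, o.IsLeadingExponent f w → ¬ w ≤ u :=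
    fun f hf w hw => hcon _ ⟨f, hf, rfl⟩ w hw.leastForm
  -- There are finitely many exponents of a given weight because no `n i` vanishes. The minimal `b`
  -- below `u` can still be rewritten by an element of `G`, within the same weight, which
  -- contradicts minimality.
  obtain ⟨b, ⟨hb, hbu⟩, hmin⟩ := o.exists_minimal
    (T := {b | Finsupp.weight n b = Finsupp.weight n u ∧ o.lt b u})
    ((Finsupp.finite_of_nat_weight_le n hn (Finsupp.weight n u)).subset fun b hb => hb.1.le)
    ⟨v, hw, huf.2 v hv hvu⟩
  obtain ⟨g, hg, w, hgw, h⟩ := hinj b u (fun h => o.irrefl u (h ▸ hbu)) hb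
  have hwb : w ≤ b := h.resolve_right (hstd g hg w hgw)
  obtain ⟨w', hw', hw'w, hwt⟩ := exists_weight_eq_of_mem_toricIdeal (hG hg) hgw.1
  have hlt := hgw.2 w' hw' hw'w
  have hb' : w + (b - w) = b := add_tsub_cancel_of_le hwb
  have hlt' : o.lt (w' + (b - w)) b := by
    conv_rhs => rw [← hb']
    exact o.add_right _ _ _ hlt
  refine hmin (w' + (b - w)) ⟨?_, o.trans _ _ _ hlt' hbu⟩ hlt'
  rw [map_add, hwt, ← map_add, hb', hb]

end TangentCone

/-! ### Arithmetic of the semigroup -/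

/-- The standing assumptions on the parameters. -/
structure PSParams.Admissible (p : PSParams) : Prop where
  valid : p.Valid
  α₄_eq : p.α₄ = 3
  gcd_eq : Finset.univ.gcd p.n = 1
  n_lt₁ : p.n 0 < p.n 1
  n_lt₂ : p.n 1 < p.n 2
  n_lt₃ : p.n 2 < p.n 3
  lt_α₂ : p.α₂₁ + 1 < p.α₂

namespace PSParams

variable {p : PSParams}

lemma n_cast (hp : p.Valid) (h4 : p.α₄ = 3) :
    (p.n 0 : ℤ) = 2 * p.α₂ * p.α₃ + 1 ∧
    (p.n 1 : ℤ) = 3 * p.α₂₁ * p.α₃ + (p.α₁ - p.α₂₁ - 1) * (p.α₃ - 1) + p.α₃ ∧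
    (p.n 2 : ℤ) = 3 * p.α₁ + 2 * (p.α₁ - p.α₂₁ - 1) * (p.α₂ - 1) - 2 ∧
    (p.n 3 : ℤ) = p.α₁ * p.α₂ * (p.α₃ - 1) + p.α₂₁ * (p.α₂ - 1) + p.α₂ := by
  obtain ⟨h1, h2, h3, -, -, h21⟩ := hp
  obtain ⟨a, b, c, d, e⟩ := p
  simp only at h1 h2 h3 h4 h21
  obtain ⟨k, rfl⟩ := Nat.exists_eq_add_of_lt h3
  obtain ⟨b, rfl⟩ := Nat.exists_eq_add_of_lt h2
  obtain ⟨m, rfl⟩ : ∃ m, a = m + e + 1 := ⟨a - e - 1, by omega⟩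
  subst h4
  have h2' : (m + e + 1) * 3 + m * (1 + b + 1 - 1) * (3 - 1) - 3 + 1 =
      (m + e) * 3 + m * (1 + b) * 2 + 1 := by
    rw [Nat.add_sub_cancel]
    omega
  simp only [n, show m + e + 1 - e - 1 = m by omega, h2', Matrix.cons_val]
  refine ⟨?_, ?_, ?_, ?_⟩ <;> push_cast [Nat.add_sub_cancel, Nat.add_sub_cancel_left] <;> ring

/-- The four generators in terms of the relations given by `f₁`, `f₂`, `f₃`. -/
lemma n_relations (hp : p.Valid) (h4 : p.α₄ = 3) :
    (p.n 3 : ℤ) = p.α₂ * p.n 1 - p.α₂₁ * p.n 0 ∧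
    (p.n 2 : ℤ) = (p.α₁ + 2 * p.α₂₁) * p.n 0 - 2 * p.α₂ * p.n 1 ∧
    (p.α₃ * p.n 2 : ℤ) = (p.α₁ - p.α₂₁ - 1) * p.n 0 + p.n 1 := by
  obtain ⟨h0, h1, h2, h3⟩ := n_cast hp h4
  rw [h0, h1, h2, h3]
  refine ⟨?_, ?_, ?_⟩ <;> ring

namespace Admissible

/-- These are the degree comparisons deciding the least forms of `f₃`, `f₇` and `f₅`. They are
extracted from `n 0 < n 1 < n 2 < n 3`. -/
lemma bounds (h : p.Admissible) :
    p.α₃ + p.α₂₁ < p.α₁ ∧ 2 * p.α₂ + 2 ≤ p.α₁ + 2 * p.α₂₁ ∧ 4 ≤ p.α₂₁ + p.α₃ := by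
  obtain ⟨⟨h1, h2, h3, -, h5, h6⟩, h4, -, l1, l2, l3, h7⟩ := h
  obtain ⟨e0, e1, e2, e3⟩ := n_cast ⟨h1, h2, h3, by omega, h5, h6⟩ h4
  zify at l1 l2 l3
  rw [e0, e1] at l1
  rw [e1, e2] at l2
  rw [e2, e3] at l3
  clear e0 e1 e2 e3
  obtain ⟨m, hm⟩ : ∃ m, p.α₁ = m + p.α₂₁ + 1 := ⟨p.α₁ - p.α₂₁ - 1, by omega⟩
  obtain ⟨k, hk⟩ : ∃ k, p.α₃ = k + 1 := ⟨p.α₃ - 1, by omega⟩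
  generalize p.α₂₁ = e at *
  generalize p.α₂ = b at *
  rw [hm] at l1 l2 l3 ⊢
  rw [hk] at l1 l2 l3 ⊢
  push_cast at l1 l2 l3
  have hm1 : 1 ≤ m := by omega
  have hk1 : 1 ≤ k := by omega
  clear hm hk h1 h2 h3 h6 h4
  zify at *
  generalize (m : ℤ) = m at *
  generalize (k : ℤ) = k at *
  generalize (e : ℤ) = e at *
  generalize (b : ℤ) = b at *
  have l1' : m + 1 < (k + 1) * (m + 3 * e + 1 - 2 * b) := by linarith
  have l2' : (m + 3 * e + 1) * k < m * (2 * b + 1) := by linarith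
  have hpos : 0 < m + 3 * e + 1 - 2 * b := by
    by_contra! hneg
    nlinarith
  -- In the excluded case of equality, `n 0 < n 1` gives `m < k` and `n 1 < n 2` gives `k < m`.
  have hb : 2 * b + 1 ≤ m + 3 * e := by
    by_contra! hlt
    have heq : m + 3 * e = 2 * b := by omega
    rw [heq] at l1' l2'
    nlinarith
  have hkm : k < m := by
    by_contra! hle
    nlinarith
  -- Only `e = k = 1` remains to be excluded; there `n 0 < n 1` gives `4b ≤ m + 6` and `n 2 < n 3`
  -- gives `mb + m + 5 < 4b`.
  refine ⟨by omega, by omega, ?_⟩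
  by_contra! hlt
  have he : e = 1 := by omega
  have hk' : k = 1 := by omega
  subst he hk'
  nlinarith

/-- By `n_relations`, `n 2` and `n 3` are integral combinations of `n 0` and `n 1`, so a common
divisor of these two divides all generators. -/
lemma coprime (h : p.Admissible) : IsCoprime (p.n 0 : ℤ) (p.n 1) := by
  rw [Nat.isCoprime_iff_coprime, Nat.Coprime, ← Nat.dvd_one, ← h.gcd_eq]
  obtain ⟨r3, r2, -⟩ := n_relations h.valid h.α₄_eq
  have d0 : ((Nat.gcd (p.n 0) (p.n 1) : ℕ) : ℤ) ∣ p.n 0 :=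
    Int.natCast_dvd_natCast.2 (Nat.gcd_dvd_left _ _)
  have d1 : ((Nat.gcd (p.n 0) (p.n 1) : ℕ) : ℤ) ∣ p.n 1 :=
    Int.natCast_dvd_natCast.2 (Nat.gcd_dvd_right _ _)
  refine Finset.dvd_gcd fun i _ => Int.natCast_dvd_natCast.1 ?_
  fin_cases i
  · exact d0
  · exact d1
  · show _ ∣ ((p.n 2 : ℕ) : ℤ)
    rw [r2]
    exact dvd_sub (d0.mul_left _) (d1.mul_left _)
  · show _ ∣ ((p.n 3 : ℕ) : ℤ)
    rw [r3]
    exact dvd_sub (d1.mul_left _) (d0.mul_left _)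

lemma n_ne_zero (h : p.Admissible) (i : Fin 4) : p.n i ≠ 0 := by
  have h0 : p.n 0 ≠ 0 := by simp [n]
  have := h.n_lt₁
  have := h.n_lt₂
  have := h.n_lt₃
  fin_cases i <;> simp only [Fin.zero_eta, Fin.mk_one, Fin.reduceFinMk] <;> omega

/-- The exponent vectors of `f₁`, `f₂`, `f₃` generate all integral relations between the
generators. -/
lemma exists_lattice_coordinates (h : p.Admissible) {z₀ z₁ z₂ z₃ : ℤ}
    (hz : p.n 0 * z₀ + p.n 1 * z₁ + p.n 2 * z₂ + p.n 3 * z₃ = 0) :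
    ∃ x y w : ℤ, z₀ = x * p.α₁ - y * p.α₂₁ - w * (p.α₁ - p.α₂₁ - 1) ∧ z₁ = y * p.α₂ - w ∧
      z₂ = w * p.α₃ - x ∧ z₃ = -2 * x - y := by
  obtain ⟨r3, r2, r1⟩ := n_relations h.valid h.α₄_eq
  -- Eliminating `n 2` and `n 3` leaves a relation between `n 0` and `n 1`; the quotient `w` is the
  -- coefficient of the vector of `f₃`, and `z₂`, `z₃` then determine the other two.
  have hdvd : (p.n 0 : ℤ) ∣ p.n 1 * (2 * p.α₂ * z₂ - p.α₂ * z₃ - z₁) :=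
    ⟨z₀ + (p.α₁ + 2 * p.α₂₁) * z₂ - p.α₂₁ * z₃, by
      rw [r2, r3] at hz
      linear_combination -hz⟩
  obtain ⟨w, hw⟩ := h.coprime.dvd_of_dvd_mul_left hdvd
  have e0 := (n_cast h.valid h.α₄_eq).1
  have hn0 : (p.n 0 : ℤ) ≠ 0 := by exact_mod_cast h.n_ne_zero 0
  refine ⟨w * p.α₃ - z₂, -2 * (w * p.α₃ - z₂) - z₃, w, ?_, ?_, by ring, by ring⟩
  · refine mul_left_cancel₀ hn0 ?_
    have hz1 : z₁ = 2 * p.α₂ * z₂ - p.α₂ * z₃ - p.n 0 * w := by linear_combination -hw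
    rw [hz1] at hz
    linear_combination hz - z₃ * r3 - z₂ * r2 + w * (p.n 1 * e0 - r1 + p.α₃ * r2)
  · rw [e0] at hw
    linear_combination -hw

end Admissible

/-! ### Combinatorics of the relation lattice -/

/-- Membership of a monomial in the ideal of leading monomials, on the level of exponents. -/
inductive DominatesLead (a b c e s t z₀ z₁ z₂ z₃ : ℤ) : Prop
  | f₁ (h₂ : 1 ≤ z₂) (h₃ : 2 ≤ z₃)
  | f₂ (h₀ : e ≤ z₀) (h₃ : 1 ≤ z₃)
  | f₃ (h₂ : c ≤ z₂)
  | f₄ (h₃ : 3 ≤ z₃)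
  | f₅ (h₁ : 1 ≤ z₁) (h₃ : 2 ≤ z₃)
  | f₆ (h₁ : b ≤ z₁) (h₂ : 1 ≤ z₂) (h₃ : 1 ≤ z₃)
  | f₇ (h₁ : 2 * b ≤ z₁) (h₂ : 1 ≤ z₂)
  | g (i : ℤ) (hi : 0 ≤ i) (his : i < s) (h₀ : i * a + (2 * i + 2) * e + 1 ≤ z₀)
      (h₂ : c - (i + 1) ≤ z₂)
  | g_last (h₁ : (2 * s + 1) * b + 1 ≤ z₁) (h₃ : 1 ≤ z₃)
  | h (j : ℤ) (hj : s ≤ j) (hjt : j < t) (h₀ : j * a + (2 * j + 3) * e + 1 ≤ z₀)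
      (h₂ : c - (j + 1) ≤ z₂)
  | h_last (h₁ : (2 * t + 2) * b + 1 ≤ z₁)

/-- When neither `z` nor `-z` is covered by `f₃`, the entry `z₂ = w * c - x` is smaller than `c` in
absolute value, which traps `w` between `0` and `x`. -/
lemma quotient_bounds {x w c : ℤ} (hc : 2 ≤ c) (h : w * c - x < c) (h' : -(w * c - x) < c) :
    (0 ≤ x → 0 ≤ w ∧ w ≤ x) ∧ (x ≤ 0 → x ≤ w ∧ w ≤ 0) := by
  refine ⟨fun hx => ⟨?_, ?_⟩, fun hx => ⟨?_, ?_⟩⟩ <;> by_contra! hlt <;> nlinarith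

/-- Half of the relations: those with `z₃ > 0`, or `z₃ = 0` and `x > 0`. -/
lemma dominatesLead_or_of_pos {a b c e s t : ℤ} (hb : 1 ≤ b) (hc : 2 ≤ c) (he : 0 ≤ e)
    (ha : e + 1 ≤ a) (hst : s ≤ t) (htc : t < c) {x y w : ℤ}
    (hpos : 0 < -2 * x - y ∨ -2 * x - y = 0 ∧ 0 < x) :
    DominatesLead a b c e s t (x * a - y * e - w * (a - e - 1)) (y * b - w) (w * c - x)
      (-2 * x - y) ∨
    DominatesLead a b c e s t (-(x * a - y * e - w * (a - e - 1))) (-(y * b - w)) (-(w * c - x))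
      (-(-2 * x - y)) := by
  obtain ⟨u, rfl⟩ : ∃ u, y = -2 * x - u := ⟨-2 * x - y, by ring⟩
  have hu : -2 * x - (-2 * x - u) = u := by ring
  rw [hu] at hpos ⊢
  obtain ⟨m, rfl⟩ : ∃ m, a = m + e + 1 := ⟨a - e - 1, by ring⟩
  have hm : 0 ≤ m := by omega
  have hb0 : 0 ≤ b := by omega
  have hc0 : 0 ≤ c := by omega
  by_contra hcon
  obtain ⟨h1, h2⟩ := not_or.1 hcon
  obtain ⟨hx0, hx0'⟩ := quotient_bounds hc (not_le.1 fun h => h1 (.f₃ h))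
    (not_le.1 fun h => h2 (.f₃ h))
  rcases le_or_gt x 0 with hx | hx
  · have hu0 : 1 ≤ u := hpos.elim id fun h => absurd h.2 hx.not_gt
    obtain ⟨hw', hw⟩ := hx0' hx
    clear hx0 hx0' hpos
    rcases hx.eq_or_lt with rfl | hx
    · obtain rfl : w = 0 := le_antisymm hw hw'
      exact h1 (.f₂ (by linarith [mul_nonneg (sub_nonneg.2 hu0) he]) hu0)
    · have hx1 : 0 ≤ -x - 1 := by omega
      rcases hu0.eq_or_lt with rfl | hu1
      · have hz1 : b ≤ (-2 * x - 1) * b - w := by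
          linarith [mul_nonneg hx1 hb0]
        have hz2 : w * c - x ≤ 0 := by
          by_contra! hlt
          exact h1 (.f₆ hz1 hlt le_rfl)
        have hw1 : w ≤ -1 := by
          have : w ≠ 0 := by
            rintro rfl
            linarith
          omega
        rcases le_or_gt s (-x - 1) with hxs | hxs
        · exact h1 (.g_last (by linarith [mul_nonneg (sub_nonneg.2 hxs) hb0]) le_rfl)
        · have h3 : -(w * c - x) < c := not_le.1 fun h => h2 (.f₃ h)
          obtain rfl : w = -1 := by
            have : -2 < w := by
              by_contra! hlt
              linarith [mul_nonneg (sub_nonneg.2 hlt) hc0]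
            omega
          exact h2 (.g (-x - 1) hx1 hxs (by linarith) (by linarith))
      · rcases hw.eq_or_lt with rfl | hw
        · exact h1 (.f₁ (by linarith) hu1)
        · have hu2 : u < 3 := not_le.1 fun h => h1 (.f₄ h)
          obtain rfl : u = 2 := by omega
          exact h1 (.f₅ (by linarith [mul_nonneg hx1 hb0]) le_rfl)
  · obtain ⟨hw, hw'⟩ := hx0 hx.le
    have hu0 : 0 ≤ u := hpos.elim le_of_lt fun h => h.1.ge
    clear hx0 hx0' hpos
    have hz0 : u * e ≤ x * (m + e + 1) - (-2 * x - u) * e - w * (m + e + 1 - e - 1) := by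
      linarith [mul_nonneg hm (sub_nonneg.2 hw'), mul_nonneg hx.le he]
    rcases hu0.eq_or_lt with rfl | hu1
    · have hz2 : -(w * c - x) ≤ 0 := by
        by_contra! hlt
        exact h2 (.f₇ (by linarith [mul_nonneg (show 0 ≤ x - 1 by omega) hb0]) hlt)
      have hw1 : 1 ≤ w := by
        have : w ≠ 0 := by
          rintro rfl
          linarith
        omega
      have hxt : x ≤ t := by
        by_contra! hlt
        exact h2 (.h_last (by linarith [mul_nonneg (show 0 ≤ x - t - 1 by omega) hb0]))
      have h3 : w * c - x < c := not_le.1 fun h => h1 (.f₃ h)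
      obtain rfl : w = 1 := by
        have : w < 2 := by
          by_contra! hlt
          linarith [mul_nonneg (sub_nonneg.2 hlt) hc0]
        omega
      -- Now `-z` is the exponent vector of `h j` for `j = x - 1`. For `j < s` the term of `g j` in
      -- `X 0` and `X 2` divides that of `h j`, so these `h j` are not needed in `G`.
      rcases lt_or_ge (x - 1) s with hxs | hxs
      · exact h1 (.g (x - 1) (by omega) hxs (by linarith) (by linarith))
      · exact h1 (.h (x - 1) hxs (by omega) (by linarith) (by linarith))
    · exact h1 (.f₂ (le_trans (by linarith [mul_nonneg (sub_nonneg.2 (show 1 ≤ u from hu1)) he])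
        hz0) hu1)

/-- The claim is symmetric under `z ↦ -z`, so a sign can be normalized; what is left over is `x = y
= 0`, a nonzero multiple of the vector of `f₃`. -/
lemma dominatesLead_or {a b c e s t : ℤ} (hb : 1 ≤ b) (hc : 2 ≤ c) (he : 0 ≤ e)
    (ha : e + 1 ≤ a) (hst : s ≤ t) (htc : t < c) {x y w z₀ z₁ z₂ z₃ : ℤ}
    (h₀ : z₀ = x * a - y * e - w * (a - e - 1)) (h₁ : z₁ = y * b - w) (h₂ : z₂ = w * c - x)
    (h₃ : z₃ = -2 * x - y) (hne : ¬ (z₀ = 0 ∧ z₁ = 0 ∧ z₂ = 0 ∧ z₃ = 0)) :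
    DominatesLead a b c e s t z₀ z₁ z₂ z₃ ∨
      DominatesLead a b c e s t (-z₀) (-z₁) (-z₂) (-z₃) := by
  subst h₀ h₁ h₂ h₃
  by_cases hpos : 0 < -2 * x - y ∨ -2 * x - y = 0 ∧ 0 < x
  · exact dominatesLead_or_of_pos hb hc he ha hst htc hpos
  by_cases hneg : 0 < -2 * (-x) - (-y) ∨ -2 * (-x) - (-y) = 0 ∧ 0 < -x
  · have := dominatesLead_or_of_pos hb hc he ha hst htc (w := -w) hneg
    rw [or_comm]
    convert this using 2 <;> ring
  · have hx : x = 0 := by omega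
    have hy : y = 0 := by omega
    subst hx hy
    have hw : w ≠ 0 := by
      rintro rfl
      simp at hne
    rcases lt_or_gt_of_ne hw with hw | hw
    · exact Or.inr (.f₃ (by nlinarith))
    · exact Or.inl (.f₃ (by nlinarith))

end PSParams

/-! ### Binomials -/

section Binomials

variable {K : Type*} [Field K] {m : ℕ} {u v : Fin m →₀ ℕ}

lemma coeff_binomial (w : Fin m →₀ ℕ) : coeff w (monomial u (1 : K) - monomial v 1) =
    (if u = w then 1 else 0) - if v = w then 1 else 0 := by
  classical
  rw [coeff_sub, coeff_monomial, coeff_monomial]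

lemma mem_support_binomial (h : u ≠ v) :
    u ∈ (monomial u (1 : K) - monomial v 1).support := by
  rw [mem_support_iff, coeff_binomial, if_pos rfl, if_neg h.symm, sub_zero]
  exact one_ne_zero

lemma eq_or_eq_of_mem_support_binomial {w : Fin m →₀ ℕ}
    (hw : w ∈ (monomial u (1 : K) - monomial v 1).support) : w = u ∨ w = v := by
  rw [mem_support_iff, coeff_binomial] at hw
  by_contra! h
  rw [if_neg h.1.symm, if_neg h.2.symm, sub_zero] at hw
  exact hw rfl

namespace LocalDegreeOrder

lemma isLeadingExponent_binomial (o : LocalDegreeOrder m) (h : o.lt v u) :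
    o.IsLeadingExponent (monomial u (1 : K) - monomial v 1) u := by
  refine ⟨mem_support_binomial fun huv => o.irrefl u (by rwa [← huv] at h), fun b hb hbu => ?_⟩
  rwa [(eq_or_eq_of_mem_support_binomial hb).resolve_left hbu]

lemma isLeadingExponent_binomial' (o : LocalDegreeOrder m) (h : o.lt v u) :
    o.IsLeadingExponent (monomial v (1 : K) - monomial u 1) u := by
  have := o.isLeadingExponent_binomial (K := K) h
  rw [IsLeadingExponent] at this ⊢
  rwa [← neg_sub, support_neg]

end LocalDegreeOrder

lemma leastForm_binomial_of_lt (h : u.degree < v.degree) :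
    leastForm (monomial u (1 : K) - monomial v 1) = monomial u 1 := by
  rw [leastForm_eq_homogeneousComponent (a := u) (mem_support_binomial fun h' => by simp [h'] at h)]
  · rw [map_sub, homogeneousComponent_of_mem (isHomogeneous_monomial 1 rfl),
      homogeneousComponent_of_mem (isHomogeneous_monomial 1 rfl), if_pos rfl, if_neg h.ne, sub_zero]
  · intro b hb
    rcases eq_or_eq_of_mem_support_binomial hb with rfl | rfl
    · exact le_rfl
    · exact h.le

lemma leastForm_binomial_of_gt (h : v.degree < u.degree) :
    leastForm (monomial u (1 : K) - monomial v 1) = -monomial v 1 := by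
  rw [← neg_sub, leastForm_neg, leastForm_binomial_of_lt h]

lemma leastForm_binomial_of_eq (h : u.degree = v.degree) :
    leastForm (monomial u (1 : K) - monomial v 1) = monomial u 1 - monomial v 1 := by
  by_cases huv : u = v
  · simp [huv]
  rw [leastForm_eq_homogeneousComponent (a := u) (mem_support_binomial huv)]
  · rw [map_sub, homogeneousComponent_of_mem (isHomogeneous_monomial 1 rfl),
      homogeneousComponent_of_mem (isHomogeneous_monomial 1 rfl), if_pos rfl, if_pos h]
  · intro b hb
    rcases eq_or_eq_of_mem_support_binomial hb with rfl | rfl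
    · exact le_rfl
    · exact h.le

lemma leastForm_binomial_mem {J : Ideal (MvPolynomial (Fin m) K)} (hu : monomial u 1 ∈ J)
    (hv : monomial v 1 ∈ J) : leastForm (monomial u (1 : K) - monomial v 1) ∈ J := by
  rcases lt_trichotomy u.degree v.degree with h | h | h
  · rwa [leastForm_binomial_of_lt h]
  · rw [leastForm_binomial_of_eq h]
    exact J.sub_mem hu hv
  · rw [leastForm_binomial_of_gt h]
    exact J.neg_mem hv

end Binomials

/-! ### Monomials in four variables -/

/-- The exponent vector with the given four entries. -/
noncomputable def exponent (a b c d : ℕ) : Fin 4 →₀ ℕ :=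
  Finsupp.single 0 a + Finsupp.single 1 b + Finsupp.single 2 c + Finsupp.single 3 d

section Exponent

variable {a b c d : ℕ}

@[simp] lemma exponent_apply_zero : exponent a b c d 0 = a := by simp [exponent]
@[simp] lemma exponent_apply_one : exponent a b c d 1 = b := by simp [exponent]
@[simp] lemma exponent_apply_two : exponent a b c d 2 = c := by simp [exponent]
@[simp] lemma exponent_apply_three : exponent a b c d 3 = d := by simp [exponent]

lemma exponent_le_iff {u : Fin 4 →₀ ℕ} :
    exponent a b c d ≤ u ↔ a ≤ u 0 ∧ b ≤ u 1 ∧ c ≤ u 2 ∧ d ≤ u 3 := by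
  simp [Finsupp.le_def, Fin.forall_fin_succ]

lemma degree_exponent : (exponent a b c d).degree = a + b + c + d := by
  simp [exponent, map_add]

lemma weight_fin_four (n : Fin 4 → ℕ) (u : Fin 4 →₀ ℕ) :
    Finsupp.weight n u = u 0 * n 0 + u 1 * n 1 + u 2 * n 2 + u 3 * n 3 := by
  rw [Finsupp.weight_apply, Finsupp.sum_fintype _ _ (by simp), Fin.sum_univ_four]
  rfl

lemma monomial_exponent (K : Type*) [Field K] : monomial (exponent a b c d) (1 : K) =
    X 0 ^ a * X 1 ^ b * X 2 ^ c * X 3 ^ d := by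
  simp [exponent, X_pow_eq_monomial, monomial_mul]

end Exponent

/-! ### The elements of `G` as differences of monomials -/

namespace PSParams

variable (K : Type*) [Field K] {p : PSParams}

lemma f₁_eq (h4 : p.α₄ = 3) :
    p.f₁ K = monomial (exponent p.α₁ 0 0 0) 1 - monomial (exponent 0 0 1 2) 1 := by
  simp [f₁, h4, monomial_exponent]

lemma f₂_eq : p.f₂ K = monomial (exponent 0 p.α₂ 0 0) 1 - monomial (exponent p.α₂₁ 0 0 1) 1 := by
  simp [f₂, monomial_exponent]

lemma f₃_eq : p.f₃ K = monomial (exponent 0 0 p.α₃ 0) 1 -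
    monomial (exponent (p.α₁ - p.α₂₁ - 1) 1 0 0) 1 := by
  simp [f₃, monomial_exponent]

lemma f₄_eq (h4 : p.α₄ = 3) : p.f₄ K = monomial (exponent 0 0 0 3) 1 -
    monomial (exponent 1 (p.α₂ - 1) (p.α₃ - 1) 0) 1 := by
  simp [f₄, h4, monomial_exponent]

lemma f₅_eq (h4 : p.α₄ = 3) : p.f₅ K = monomial (exponent (p.α₂₁ + 1) 0 (p.α₃ - 1) 0) 1 -
    monomial (exponent 0 1 0 2) 1 := by
  simp [f₅, h4, monomial_exponent]

lemma f₆_eq : p.f₆ K = monomial (exponent (p.α₁ + p.α₂₁) 0 0 0) 1 -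
    monomial (exponent 0 p.α₂ 1 1) 1 := by
  simp [f₆, monomial_exponent]

lemma f₇_eq : p.f₇ K = monomial (exponent (p.α₁ + 2 * p.α₂₁) 0 0 0) 1 -
    monomial (exponent 0 (2 * p.α₂) 1 0) 1 := by
  simp [f₇, monomial_exponent]

lemma g_eq (i : ℕ) : p.g K i = monomial (exponent 0 ((2 * i + 1) * p.α₂ + 1) 0 1) 1 -
    monomial (exponent (i * p.α₁ + (2 * i + 2) * p.α₂₁ + 1) 0 (p.α₃ - (i + 1)) 0) 1 := by
  simp [g, monomial_exponent]

lemma h_eq (j : ℕ) : p.h K j = monomial (exponent 0 ((2 * j + 2) * p.α₂ + 1) 0 0) 1 -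
    monomial (exponent (j * p.α₁ + (2 * j + 3) * p.α₂₁ + 1) 0 (p.α₃ - (j + 1)) 0) 1 := by
  simp [h, monomial_exponent]

lemma leadsG_iff {o : LocalDegreeOrder 4} {i : ℕ} : p.LeadsG o i ↔
    o.lt (exponent 0 ((2 * i + 1) * p.α₂ + 1) 0 1)
      (exponent (i * p.α₁ + (2 * i + 2) * p.α₂₁ + 1) 0 (p.α₃ - (i + 1)) 0) := by
  simp [LeadsG, exponent]

/-- Induction on the elements of the set `G`. -/
lemma forall_mem_basisSet {s l : ℕ} {P : MvPolynomial (Fin 4) K → Prop} :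
    (∀ f ∈ p.basisSet K s l, P f) ↔ P (p.f₁ K) ∧ P (p.f₂ K) ∧ P (p.f₃ K) ∧ P (p.f₄ K) ∧
      P (p.f₅ K) ∧ P (p.f₆ K) ∧ P (p.f₇ K) ∧ (∀ i ≤ s, P (p.g K i)) ∧
      ∀ j, s ≤ j → j ≤ l → P (p.h K j) := by
  simp only [basisSet, Set.mem_union, Set.mem_insert_iff, Set.mem_singleton_iff, Set.mem_ofPred_eq]
  constructor
  · intro H
    refine ⟨H _ ?_, H _ ?_, H _ ?_, H _ ?_, H _ ?_, H _ ?_, H _ ?_,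
      fun i hi => H _ (Or.inl (Or.inr ⟨i, hi, rfl⟩)), fun j hj hj' => H _ (Or.inr ⟨j, hj, hj', rfl⟩)⟩
      <;> simp
  · rintro ⟨h1, h2, h3, h4, h5, h6, h7, hg, hh⟩ f
      (((rfl | rfl | rfl | rfl | rfl | rfl | rfl) | ⟨i, hi, rfl⟩) | ⟨j, hj, hj', rfl⟩)
    exacts [h1, h2, h3, h4, h5, h6, h7, hg i hi, hh j hj hj']

lemma finite_basisSet (s l : ℕ) : (p.basisSet K s l).Finite := by
  refine ((Set.toFinite _).union ?_).union ?_
  · refine ((Set.finite_Iic s).image (p.g K)).subset ?_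
    rintro _ ⟨i, hi, rfl⟩
    exact ⟨i, hi, rfl⟩
  · refine ((Set.finite_Iic l).image (p.h K)).subset ?_
    rintro _ ⟨j, -, hj, rfl⟩
    exact ⟨j, hj, rfl⟩

/-! ### Bounds on `s` and `l`; the toric ideal contains `G` -/

namespace Admissible

variable {s l : ℕ}

/-- The inequality defining `l` implies the one defining `s` at the same index, because `α₂ ≥ α₂₁ +
2`. -/
lemma s_le_l (H : p.Admissible) (hs : p.IsS s) (hl : p.IsL l) : s ≤ l := by
  refine hs.2 ?_
  have h1 := hl.1
  have h2 := H.lt_α₂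
  simp only [Set.mem_ofPred_eq] at h1 ⊢
  nlinarith

/-- The inequality defining `l`, taken at `α₃ - 1`, is precisely `n 0 < n 1`. -/
lemma l_lt_α₃ (H : p.Admissible) (hl : p.IsL l) : l < p.α₃ := by
  have h1 := H.n_lt₁
  obtain ⟨e0, e1, -, -⟩ := n_cast H.valid H.α₄_eq
  have h3 := H.valid.2.2.1
  obtain ⟨k, hk⟩ : ∃ k, p.α₃ = k + 1 := ⟨p.α₃ - 1, by omega⟩
  suffices l ≤ k by omega
  refine hl.2 ?_
  simp only [Set.mem_ofPred_eq]
  zify at h1 ⊢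
  rw [e0, e1, hk] at h1
  rw [hk]
  push_cast at h1 ⊢
  linarith

lemma basisSet_subset_toricIdeal (H : p.Admissible) (hs : p.IsS s) (hl : p.IsL l) :
    ∀ f ∈ p.basisSet K s l, f ∈ toricIdeal K p.n := by
  have hsl := H.s_le_l hs hl
  have hlc := H.l_lt_α₃ hl
  obtain ⟨r3, r2, r1⟩ := n_relations H.valid H.α₄_eq
  obtain ⟨b1, b2, b3⟩ := H.bounds
  have hv := H.valid
  obtain ⟨v1, v2, v3, v4, v5, v6⟩ := hv
  have c1 : ((p.α₁ - p.α₂₁ - 1 : ℕ) : ℤ) = p.α₁ - p.α₂₁ - 1 := by omega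
  have c2 : ((p.α₂ - 1 : ℕ) : ℤ) = p.α₂ - 1 := by omega
  have c3 : ((p.α₃ - 1 : ℕ) : ℤ) = p.α₃ - 1 := by omega
  have c4 : ∀ i, i ≤ l → ((p.α₃ - (i + 1) : ℕ) : ℤ) = p.α₃ - (i + 1) := by omega
  rw [forall_mem_basisSet, f₁_eq K H.α₄_eq, f₂_eq, f₃_eq, f₄_eq K H.α₄_eq, f₅_eq K H.α₄_eq, f₆_eq,
    f₇_eq]
  refine ⟨?_, ?_, ?_, ?_, ?_, ?_, ?_, fun i hi => ?_, fun j _ hj => ?_⟩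
  on_goal 8 => rw [g_eq]
  on_goal 9 => rw [h_eq]
  all_goals
    refine monomial_sub_monomial_mem_toricIdeal ?_
    simp only [weight_fin_four, exponent_apply_zero, exponent_apply_one, exponent_apply_two,
      exponent_apply_three]
    zify
    try rw [c4 _ (by omega)]
    try rw [c1]
    try rw [c2]
    try rw [c3]
  · linear_combination -r2 - 2 * r3
  · linear_combination -r3
  · linear_combination r1
  · linear_combination 3 * r3 - r1 + r2
  · linear_combination r1 - r2 - 2 * r3
  · linear_combination -r2 - r3
  · linear_combination -r2
  · linear_combination r3 - r1 + (i + 1) * r2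
  · linear_combination -r1 + (j + 1) * r2

end Admissible

end PSParams

/-! ### A criterion for a quotient ring not to be Cohen–Macaulay -/

lemma mem_of_constantCoeff_eq_zero {K : Type*} [Field K] {σ : Type*}
    {J : Ideal (MvPolynomial σ K)} (hJ : ∀ i, X i ∈ J) {f : MvPolynomial σ K}
    (hf : constantCoeff f = 0) : f ∈ J := by
  have key : ∀ g : MvPolynomial σ K, g - C (constantCoeff g) ∈ J := by
    intro g
    induction g using MvPolynomial.induction_on with
    | C a => simp
    | add p q hp hq =>
      rw [map_add, map_add, add_sub_add_comm]
      exact J.add_mem hp hq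
    | mul_X p i _ =>
      simpa using J.mul_mem_left p (hJ i)
  simpa [hf] using key f

/-- A local ring of positive dimension in which the maximal ideal consists of zero divisors is not
Cohen–Macaulay. -/
lemma not_isCohenMacaulayLocal {R : Type*} [CommRing R] [IsLocalRing R] {x y : R}
    (hx : x ∈ IsLocalRing.maximalIdeal R) (hxn : ¬ IsNilpotent x) (hy : y ≠ 0)
    (hle : IsLocalRing.maximalIdeal R ≤ (Ideal.span {y}).annihilator.radical) :
    ¬ IsCohenMacaulayLocal R := by
  rintro ⟨-, rs, hmem, hreg, hlen⟩
  rcases rs with _ | ⟨r, rs⟩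
  -- An empty sequence means dimension zero, where every element of the maximal ideal is nilpotent.
  · have : Ring.KrullDimLE 0 R := by
      rw [Ring.krullDimLE_iff, ← hlen]
      simp
    exact hxn (Ring.KrullDimLE.isNilpotent_iff_mem_maximalIdeal.2 hx)
  · have hr : IsSMulRegular R r := ((RingTheory.Sequence.isRegular_cons_iff R r rs).1 hreg).1
    obtain ⟨k, hk⟩ := hle (hmem r List.mem_cons_self)
    rw [Submodule.mem_annihilator_span_singleton] at hk
    exact hy ((hr.pow k) (by simpa using hk))

/-- If a quotient of a polynomial ring has, locally at the origin, positive dimension and a nonzero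
element killed by a power of every variable, then it is not Cohen–Macaulay. -/
theorem not_isCohenMacaulayRing_quotient {K : Type*} [Field K] {σ : Type*}
    {I : Ideal (MvPolynomial σ K)} (hI : ∀ f ∈ I, constantCoeff f = 0)
    {x y : MvPolynomial σ K} (hx : constantCoeff x = 0)
    (hxI : ∀ k t, x ^ k * t ∈ I → constantCoeff t = 0)
    (hyI : ∀ t, y * t ∈ I → constantCoeff t = 0) (hy : ∀ i, ∃ k, X i ^ k * y ∈ I) :
    ¬ IsCohenMacaulayRing (MvPolynomial σ K ⧸ I) := by
  rintro ⟨-, hCM⟩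
  set P : Ideal (MvPolynomial σ K ⧸ I) := RingHom.ker (Ideal.Quotient.lift I constantCoeff hI)
  have hP : ∀ f, Ideal.Quotient.mk I f ∈ P ↔ constantCoeff f = 0 := fun f => Iff.rfl
  have : P.IsPrime := RingHom.ker_isPrime _
  set ι : MvPolynomial σ K →+* Localization.AtPrime P :=
    (algebraMap _ (Localization.AtPrime P)).comp (Ideal.Quotient.mk I) with hι
  have hzero : ∀ f, ι f = 0 → ∃ t, constantCoeff t ≠ 0 ∧ f * t ∈ I := by
    intro f hf
    obtain ⟨⟨c, hc⟩, hcf⟩ :=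
      (IsLocalization.map_eq_zero_iff P.primeCompl (Localization.AtPrime P) _).1 hf
    obtain ⟨t, rfl⟩ := Ideal.Quotient.mk_surjective c
    refine ⟨t, fun h => hc ((hP t).2 h), ?_⟩
    rw [mul_comm, ← Ideal.Quotient.eq_zero_iff_mem, map_mul]
    exact hcf
  have hιI : ∀ f ∈ I, ι f = 0 := by
    intro f hf
    rw [hι, RingHom.comp_apply, Ideal.Quotient.eq_zero_iff_mem.2 hf, map_zero]
  have hmap : IsLocalRing.maximalIdeal (Localization.AtPrime P) = P.map (algebraMap _ _) :=
    Localization.AtPrime.map_eq_maximalIdeal.symm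
  refine not_isCohenMacaulayLocal (x := ι x) (y := ι y) ?_ ?_ ?_ ?_ (hCM P)
  · rw [hmap]
    exact Ideal.mem_map_of_mem _ ((hP x).2 hx)
  · rintro ⟨k, hk⟩
    rw [← map_pow] at hk
    obtain ⟨t, ht, h⟩ := hzero _ hk
    exact ht (hxI k t h)
  · intro h0
    obtain ⟨t, ht, h⟩ := hzero _ h0
    exact ht (hyI t h)
  · rw [hmap, Ideal.map_le_iff_le_comap]
    intro q hq
    obtain ⟨f, rfl⟩ := Ideal.Quotient.mk_surjective q
    change f ∈ Ideal.comap ι _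
    refine mem_of_constantCoeff_eq_zero (fun i => ?_) ((hP f).1 hq)
    obtain ⟨k, hk⟩ := hy i
    refine ⟨k, ?_⟩
    rw [← map_pow, Submodule.mem_annihilator_span_singleton, smul_eq_mul, ← map_mul, hιI _ hk]

namespace PSParams

variable (K : Type*) [Field K] {p : PSParams} {s l : ℕ}

/-! ### The least forms of the elements of `G` -/

lemma leastForm_g_of_lt {i : ℕ} (hi : i < p.α₃)
    (h : i * p.α₁ + (2 * i + 2) * p.α₂₁ + p.α₃ < (2 * i + 1) * p.α₂ + (i + 2)) :
    leastForm (p.g K i) =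
      -monomial (exponent (i * p.α₁ + (2 * i + 2) * p.α₂₁ + 1) 0 (p.α₃ - (i + 1)) 0) 1 := by
  rw [g_eq, leastForm_binomial_of_gt]
  simp only [degree_exponent]
  omega

lemma leastForm_g_of_eq {i : ℕ} (hi : i < p.α₃)
    (h : i * p.α₁ + (2 * i + 2) * p.α₂₁ + p.α₃ = (2 * i + 1) * p.α₂ + (i + 2)) :
    leastForm (p.g K i) = p.g K i := by
  rw [g_eq, leastForm_binomial_of_eq]
  simp only [degree_exponent]
  omega

lemma leastForm_h_of_lt {j : ℕ} (hj : j < p.α₃)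
    (h : j * p.α₁ + (2 * j + 3) * p.α₂₁ + p.α₃ < (2 * j + 2) * p.α₂ + (j + 1)) :
    leastForm (p.h K j) =
      -monomial (exponent (j * p.α₁ + (2 * j + 3) * p.α₂₁ + 1) 0 (p.α₃ - (j + 1)) 0) 1 := by
  rw [h_eq, leastForm_binomial_of_gt]
  simp only [degree_exponent]
  omega

lemma leastForm_h_of_eq {j : ℕ} (hj : j < p.α₃)
    (h : j * p.α₁ + (2 * j + 3) * p.α₂₁ + p.α₃ = (2 * j + 2) * p.α₂ + (j + 1)) :
    leastForm (p.h K j) = p.h K j := by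
  rw [h_eq, leastForm_binomial_of_eq]
  simp only [degree_exponent]
  omega

lemma mem_basisSet_self (s l : ℕ) : p.f₁ K ∈ p.basisSet K s l ∧ p.f₂ K ∈ p.basisSet K s l ∧
    p.f₃ K ∈ p.basisSet K s l ∧ p.f₄ K ∈ p.basisSet K s l ∧ p.f₅ K ∈ p.basisSet K s l ∧
    p.f₆ K ∈ p.basisSet K s l ∧ p.f₇ K ∈ p.basisSet K s l ∧
    (∀ i ≤ s, p.g K i ∈ p.basisSet K s l) ∧
    ∀ j, s ≤ j → j ≤ l → p.h K j ∈ p.basisSet K s l :=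
  (forall_mem_basisSet (P := fun f => f ∈ p.basisSet K s l) K).1 fun _ h => h

namespace Admissible

lemma leastForm_f₁ (H : p.Admissible) :
    leastForm (p.f₁ K) = -monomial (exponent 0 0 1 2) 1 := by
  rw [f₁_eq K H.α₄_eq, leastForm_binomial_of_gt]
  have := H.bounds
  simp only [degree_exponent]
  omega

lemma leastForm_f₂ (H : p.Admissible) :
    leastForm (p.f₂ K) = -monomial (exponent p.α₂₁ 0 0 1) 1 := by
  rw [f₂_eq, leastForm_binomial_of_gt]
  have := H.lt_α₂
  simp only [degree_exponent]
  omega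

lemma leastForm_f₃ (H : p.Admissible) :
    leastForm (p.f₃ K) = monomial (exponent 0 0 p.α₃ 0) 1 := by
  rw [f₃_eq, leastForm_binomial_of_lt]
  have := H.bounds
  simp only [degree_exponent]
  omega

lemma leastForm_f₄ (H : p.Admissible) :
    leastForm (p.f₄ K) = monomial (exponent 0 0 0 3) 1 := by
  rw [f₄_eq K H.α₄_eq, leastForm_binomial_of_lt]
  have := H.bounds
  have := H.lt_α₂
  simp only [degree_exponent]
  omega

lemma leastForm_f₅ (H : p.Admissible) :
    leastForm (p.f₅ K) = -monomial (exponent 0 1 0 2) 1 := by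
  rw [f₅_eq K H.α₄_eq, leastForm_binomial_of_gt]
  have := H.bounds
  have := H.valid.2.2.1
  simp only [degree_exponent]
  omega

lemma leastForm_f₆ (H : p.Admissible) :
    leastForm (p.f₆ K) = -monomial (exponent 0 p.α₂ 1 1) 1 := by
  rw [f₆_eq, leastForm_binomial_of_gt]
  have := H.bounds
  have := H.lt_α₂
  simp only [degree_exponent]
  omega

lemma leastForm_f₇ (H : p.Admissible) :
    leastForm (p.f₇ K) = -monomial (exponent 0 (2 * p.α₂) 1 0) 1 := by
  rw [f₇_eq, leastForm_binomial_of_gt]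
  have := H.bounds
  simp only [degree_exponent]
  omega

lemma leastForm_g_last (H : p.Admissible) (hs : p.IsS s) (hl : p.IsL l) :
    leastForm (p.g K s) = monomial (exponent 0 ((2 * s + 1) * p.α₂ + 1) 0 1) 1 := by
  rw [g_eq, leastForm_binomial_of_lt]
  have := H.s_le_l hs hl
  have := H.l_lt_α₃ hl
  have h1 := hs.1
  simp only [degree_exponent, Set.mem_ofPred_eq] at h1 ⊢
  omega

lemma leastForm_h_last (H : p.Admissible) (hl : p.IsL l) :
    leastForm (p.h K l) = monomial (exponent 0 ((2 * l + 2) * p.α₂ + 1) 0 0) 1 := by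
  rw [h_eq, leastForm_binomial_of_lt]
  have := H.l_lt_α₃ hl
  have h1 := hl.1
  simp only [degree_exponent, Set.mem_ofPred_eq] at h1 ⊢
  omega

/-! ### The standard basis -/

/-- An ordering determines how far the first of the two terms of the `h j` are the leading ones. -/
lemma exists_switch (H : p.Admissible) (hs : p.IsS s) (hl : p.IsL l) (o : LocalDegreeOrder 4) :
    ∃ t, s ≤ t ∧ t ≤ l ∧
      (∀ j, s ≤ j → j < t → o.lt (exponent 0 ((2 * j + 2) * p.α₂ + 1) 0 0)
        (exponent (j * p.α₁ + (2 * j + 3) * p.α₂₁ + 1) 0 (p.α₃ - (j + 1)) 0)) ∧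
      o.lt (exponent (t * p.α₁ + (2 * t + 3) * p.α₂₁ + 1) 0 (p.α₃ - (t + 1)) 0)
        (exponent 0 ((2 * t + 2) * p.α₂ + 1) 0 0) := by
  classical
  have hex : ∃ t, s ≤ t ∧
      o.lt (exponent (t * p.α₁ + (2 * t + 3) * p.α₂₁ + 1) 0 (p.α₃ - (t + 1)) 0)
        (exponent 0 ((2 * t + 2) * p.α₂ + 1) 0 0) := by
    refine ⟨l, H.s_le_l hs hl, o.lt_of_degree_lt _ _ ?_⟩
    have := H.l_lt_α₃ hl
    have h1 := hl.1
    simp only [degree_exponent, Set.mem_ofPred_eq] at h1 ⊢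
    omega
  refine ⟨Nat.find hex, (Nat.find_spec hex).1, ?_, fun j hj hjt => ?_, (Nat.find_spec hex).2⟩
  · refine Nat.find_min' hex ⟨H.s_le_l hs hl, o.lt_of_degree_lt _ _ ?_⟩
    have := H.l_lt_α₃ hl
    have h1 := hl.1
    simp only [degree_exponent, Set.mem_ofPred_eq] at h1 ⊢
    omega
  · rcases o.total (exponent 0 ((2 * j + 2) * p.α₂ + 1) 0 0)
      (exponent (j * p.α₁ + (2 * j + 3) * p.α₂₁ + 1) 0 (p.α₃ - (j + 1)) 0) with h | h | h
    · exact h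
    -- The two exponents differ at `X 0`: one entry is zero, the other positive.
    · have := DFunLike.congr_fun h 0
      simp at this
    · exact absurd ⟨hj, h⟩ (Nat.find_min hex hjt)

lemma exists_isLeadingExponent_le (H : p.Admissible) (hs : p.IsS s) (hl : p.IsL l)
    {o : LocalDegreeOrder 4} (ho : ∀ i < s, p.LeadsG o i) {t : ℕ} (hst : s ≤ t) (htl : t ≤ l)
    (ht : ∀ j, s ≤ j → j < t → o.lt (exponent 0 ((2 * j + 2) * p.α₂ + 1) 0 0)
        (exponent (j * p.α₁ + (2 * j + 3) * p.α₂₁ + 1) 0 (p.α₃ - (j + 1)) 0))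
    (ht' : o.lt (exponent (t * p.α₁ + (2 * t + 3) * p.α₂₁ + 1) 0 (p.α₃ - (t + 1)) 0)
        (exponent 0 ((2 * t + 2) * p.α₂ + 1) 0 0))
    {z₀ z₁ z₂ z₃ : ℤ} {u : Fin 4 →₀ ℕ} (h₀ : z₀ ≤ u 0) (h₁ : z₁ ≤ u 1) (h₂ : z₂ ≤ u 2)
    (h₃ : z₃ ≤ u 3) (hz : DominatesLead p.α₁ p.α₂ p.α₃ p.α₂₁ s t z₀ z₁ z₂ z₃) :
    ∃ f ∈ p.basisSet K s l, ∃ w, o.IsLeadingExponent f w ∧ w ≤ u := by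
  obtain ⟨m1, m2, m3, m4, m5, m6, m7, mg, mh⟩ := mem_basisSet_self K (p := p) s l
  obtain ⟨b1, b2, b3⟩ := H.bounds
  have b4 := H.lt_α₂
  have b5 := H.valid.2.2.1
  have h4 := H.α₄_eq
  have hlc := H.l_lt_α₃ hl
  have hs1 := hs.1
  simp only [Set.mem_ofPred_eq] at hs1
  cases hz with
  | f₁ k₂ k₃ =>
    refine ⟨_, m1, exponent 0 0 1 2, ?_, exponent_le_iff.2 (by omega)⟩
    rw [f₁_eq K h4]
    refine o.isLeadingExponent_binomial' (o.lt_of_degree_lt _ _ ?_)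
    simp only [degree_exponent]
    omega
  | f₂ k₀ k₃ =>
    refine ⟨_, m2, exponent p.α₂₁ 0 0 1, ?_, exponent_le_iff.2 (by omega)⟩
    rw [f₂_eq]
    refine o.isLeadingExponent_binomial' (o.lt_of_degree_lt _ _ ?_)
    simp only [degree_exponent]
    omega
  | f₃ k₂ =>
    refine ⟨_, m3, exponent 0 0 p.α₃ 0, ?_, exponent_le_iff.2 (by omega)⟩
    rw [f₃_eq]
    refine o.isLeadingExponent_binomial (o.lt_of_degree_lt _ _ ?_)
    simp only [degree_exponent]
    omega
  | f₄ k₃ =>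
    refine ⟨_, m4, exponent 0 0 0 3, ?_, exponent_le_iff.2 (by omega)⟩
    rw [f₄_eq K h4]
    refine o.isLeadingExponent_binomial (o.lt_of_degree_lt _ _ ?_)
    simp only [degree_exponent]
    omega
  | f₅ k₁ k₃ =>
    refine ⟨_, m5, exponent 0 1 0 2, ?_, exponent_le_iff.2 (by omega)⟩
    rw [f₅_eq K h4]
    refine o.isLeadingExponent_binomial' (o.lt_of_degree_lt _ _ ?_)
    simp only [degree_exponent]
    omega
  | f₆ k₁ k₂ k₃ =>
    refine ⟨_, m6, exponent 0 p.α₂ 1 1, ?_, exponent_le_iff.2 (by omega)⟩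
    rw [f₆_eq]
    refine o.isLeadingExponent_binomial' (o.lt_of_degree_lt _ _ ?_)
    simp only [degree_exponent]
    omega
  | f₇ k₁ k₂ =>
    refine ⟨_, m7, exponent 0 (2 * p.α₂) 1 0, ?_, exponent_le_iff.2 (by omega)⟩
    rw [f₇_eq]
    refine o.isLeadingExponent_binomial' (o.lt_of_degree_lt _ _ ?_)
    simp only [degree_exponent]
    omega
  | g i hi his k₀ k₂ =>
    lift i to ℕ using hi
    refine ⟨_, mg i (by omega), exponent (i * p.α₁ + (2 * i + 2) * p.α₂₁ + 1) 0 (p.α₃ - (i + 1)) 0,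
      ?_, exponent_le_iff.2
      ⟨by zify; linarith, Nat.zero_le _, by omega, Nat.zero_le _⟩⟩
    rw [g_eq]
    exact o.isLeadingExponent_binomial' (leadsG_iff.1 (ho i (by omega)))
  | g_last k₁ k₃ =>
    refine ⟨_, mg s le_rfl, exponent 0 ((2 * s + 1) * p.α₂ + 1) 0 1, ?_, exponent_le_iff.2
      ⟨Nat.zero_le _, by zify; linarith, Nat.zero_le _, by omega⟩⟩
    rw [g_eq]
    refine o.isLeadingExponent_binomial (o.lt_of_degree_lt _ _ ?_)
    simp only [degree_exponent]
    omega
  | h j hj hjt k₀ k₂ =>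
    lift j to ℕ using (by omega)
    refine ⟨_, mh j (by omega) (by omega),
      exponent (j * p.α₁ + (2 * j + 3) * p.α₂₁ + 1) 0 (p.α₃ - (j + 1)) 0, ?_, exponent_le_iff.2
      ⟨by zify; linarith, Nat.zero_le _, by omega, Nat.zero_le _⟩⟩
    rw [h_eq]
    exact o.isLeadingExponent_binomial' (ht j (by omega) (by omega))
  | h_last k₁ =>
    refine ⟨_, mh t hst htl, exponent 0 ((2 * t + 2) * p.α₂ + 1) 0 0, ?_, exponent_le_iff.2
      ⟨Nat.zero_le _, by zify; linarith, Nat.zero_le _, Nat.zero_le _⟩⟩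
    rw [h_eq]
    exact o.isLeadingExponent_binomial ht'

theorem isStandardBasis (H : p.Admissible) (hs : p.IsS s) (hl : p.IsL l)
    {o : LocalDegreeOrder 4} (ho : ∀ i < s, p.LeadsG o i) :
    o.IsStandardBasis (leastForm '' p.basisSet K s l) (tangentConeIdeal (toricIdeal K p.n)) := by
  obtain ⟨t, hst, htl, ht, ht'⟩ := H.exists_switch hs hl o
  refine o.isStandardBasis_leastForm H.n_ne_zero (finite_basisSet K s l)
    (H.basisSet_subset_toricIdeal K hs hl) fun u v huv hw => ?_
  have hlc := H.l_lt_α₃ hl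
  have b1 := H.bounds.1
  have b4 := H.lt_α₂
  have b5 := H.valid.2.2.1
  rw [weight_fin_four, weight_fin_four] at hw
  zify at hw
  -- For `z = u - v` one has `z ≤ u` and `-z ≤ v`, so lower bounds on `z` or `-z` pass to `u` or
  -- `v`.
  obtain ⟨x, y, w, e₀, e₁, e₂, e₃⟩ := H.exists_lattice_coordinates
    (z₀ := u 0 - v 0) (z₁ := u 1 - v 1) (z₂ := u 2 - v 2) (z₃ := u 3 - v 3)
    (by linear_combination hw)
  have hne : ¬ ((u 0 - v 0 : ℤ) = 0 ∧ (u 1 - v 1 : ℤ) = 0 ∧ (u 2 - v 2 : ℤ) = 0 ∧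
      (u 3 - v 3 : ℤ) = 0) := by
    rintro ⟨i₀, i₁, i₂, i₃⟩
    refine huv (Finsupp.ext fun i => ?_)
    fin_cases i <;> simp only [Fin.zero_eta, Fin.mk_one, Fin.reduceFinMk] <;> omega
  rcases dominatesLead_or (b := p.α₂) (c := p.α₃) (e := p.α₂₁) (a := p.α₁) (s := s) (t := t)
    (by omega) (by omega) (by omega) (by omega) (by omega) (by omega) e₀ e₁ e₂ e₃ hne with h | h
  · obtain ⟨f, hf, w, hw, hwu⟩ := H.exists_isLeadingExponent_le K hs hl ho hst htl ht ht' (u := u)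
      (by omega) (by omega) (by omega) (by omega) h
    exact ⟨f, hf, w, hw, Or.inl hwu⟩
  · obtain ⟨f, hf, w, hw, hwv⟩ := H.exists_isLeadingExponent_le K hs hl ho hst htl ht ht' (u := v)
      (by omega) (by omega) (by omega) (by omega) h
    exact ⟨f, hf, w, hw, Or.inr hwv⟩

/-- For `i < s` the required term of `g i` has degree at most that of the other one, and a tie is
won by the power of `X 0`, the largest variable. -/
lemma leadsG_degLex (H : p.Admissible) (hs : p.IsS s) (hl : p.IsL l) {i : ℕ} (hi : i < s) :
    p.LeadsG (LocalDegreeOrder.degLex 4) i := by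
  have h1 : ¬ (i * p.α₁ + (2 * i + 2) * p.α₂₁ + p.α₃ > (2 * i + 1) * p.α₂ + (i + 2)) :=
    fun h => absurd (hs.2 h) (by omega)
  have := H.s_le_l hs hl
  have := H.l_lt_α₃ hl
  rw [leadsG_iff]
  rcases Nat.lt_or_ge (i * p.α₁ + (2 * i + 2) * p.α₂₁ + p.α₃) ((2 * i + 1) * p.α₂ + (i + 2))
    with h | h
  · refine Or.inl ?_
    simp only [degree_exponent]
    omega
  · refine Or.inr ⟨?_, Finsupp.Lex.lt_iff.2 ⟨0, fun j hj => absurd hj (Fin.not_lt_zero j), ?_⟩⟩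
    · simp only [degree_exponent]
      omega
    · simp

theorem tangentConeIdeal_eq (H : p.Admissible) (hs : p.IsS s) (hl : p.IsL l) :
    tangentConeIdeal (toricIdeal K p.n) = Ideal.span (leastForm '' p.basisSet K s l) := by
  refine ((H.isStandardBasis K hs hl fun i => H.leadsG_degLex hs hl).span_eq ?_).symm
  rintro _ ⟨f, -, rfl⟩
  exact leastForm_isHomogeneous f

/-! ### The tangent cone is not Cohen–Macaulay -/

/-- All least forms of `G` lie in the monomial ideal generated by `X 1`, `X 2`, `X 3 ^ 3` and `X 0 *
X 3`; this upper bound is all that the local analysis at the origin needs. -/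
lemma tangentConeIdeal_le (H : p.Admissible) (hs : p.IsS s) (hl : p.IsL l)
    {J : Ideal (MvPolynomial (Fin 4) K)}
    (h : ∀ a b c d, 1 ≤ b ∨ 1 ≤ c ∨ 3 ≤ d ∨ (1 ≤ a ∧ 1 ≤ d) →
      monomial (exponent a b c d) (1 : K) ∈ J) :
    tangentConeIdeal (toricIdeal K p.n) ≤ J := by
  have hsl := H.s_le_l hs hl
  have hlc := H.l_lt_α₃ hl
  have b4 := H.lt_α₂
  have b5 := H.valid.2.2.1
  have b6 := H.valid.2.2.2.2.1
  rw [H.tangentConeIdeal_eq K hs hl, Ideal.span_le, Set.image_subset_iff]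
  refine (forall_mem_basisSet (P := fun f => leastForm f ∈ J) K).2 ⟨?_, ?_, ?_, ?_, ?_, ?_, ?_,
    fun i hi => ?_, fun j hj hjl => ?_⟩
  · rw [H.leastForm_f₁ K]
    exact J.neg_mem (h _ _ _ _ (by omega))
  · rw [H.leastForm_f₂ K]
    exact J.neg_mem (h _ _ _ _ (by omega))
  · rw [H.leastForm_f₃ K]
    exact h _ _ _ _ (by omega)
  · rw [H.leastForm_f₄ K]
    exact h _ _ _ _ (by omega)
  · rw [H.leastForm_f₅ K]
    exact J.neg_mem (h _ _ _ _ (by omega))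
  · rw [H.leastForm_f₆ K]
    exact J.neg_mem (h _ _ _ _ (by omega))
  · rw [H.leastForm_f₇ K]
    exact J.neg_mem (h _ _ _ _ (by omega))
  · rcases hi.eq_or_lt with rfl | hi
    · rw [H.leastForm_g_last K hs hl]
      exact h _ _ _ _ (by omega)
    · rw [g_eq]
      exact leastForm_binomial_mem (h _ _ _ _ (by omega)) (h _ _ _ _ (by omega))
  · rcases hjl.eq_or_lt with rfl | hj
    · rw [H.leastForm_h_last K hl]
      exact h _ _ _ _ (by omega)
    · rw [h_eq]
      exact leastForm_binomial_mem (h _ _ _ _ (by omega)) (h _ _ _ _ (by omega))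

theorem not_isCohenMacaulayRing (H : p.Admissible) (hs : p.IsS s) (hl : p.IsL l) :
    ¬ IsCohenMacaulayRing
      (MvPolynomial (Fin 4) K ⧸ tangentConeIdeal (toricIdeal K p.n)) := by
  have hcoeff : ∀ (v : Fin 4 → Polynomial K), (∀ i, (v i).coeff 0 = 0) →
      ∀ t : MvPolynomial (Fin 4) K, (aeval v t).coeff 0 = constantCoeff t := by
    intro v hv t
    induction t using MvPolynomial.induction_on with
    | C a => simp
    | add p q hp hq => simp [hp, hq]
    | mul_X p i _ => simp [Polynomial.mul_coeff_zero, hv]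
  -- Restriction to the `X 0`-axis kills the ideal, so no power of `X 0` vanishes at the origin.
  have hX : ∀ t ∈ tangentConeIdeal (toricIdeal K p.n),
      aeval ![(Polynomial.X : Polynomial K), 0, 0, 0] t = 0 := by
    refine H.tangentConeIdeal_le K hs hl (J := RingHom.ker (aeval _)) fun a b c d h => ?_
    rw [RingHom.mem_ker, monomial_exponent]
    simp
    omega
  -- Restriction to the `X 3`-axis maps the ideal into multiples of the cube, so `X 3 ^ 2` survives
  -- at the origin.
  have hW : ∀ t ∈ tangentConeIdeal (toricIdeal K p.n),
      aeval ![0, 0, 0, (Polynomial.X : Polynomial K)] t ∈ Ideal.span {Polynomial.X ^ 3} := by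
    refine H.tangentConeIdeal_le K hs hl (J := (Ideal.span _).comap (aeval _)) fun a b c d h => ?_
    rw [Ideal.mem_comap, monomial_exponent, Ideal.mem_span_singleton]
    rcases h with h | h | h | h
    · simp [show b ≠ 0 by omega]
    · simp [show c ≠ 0 by omega]
    · simp only [map_mul, map_pow, aeval_X]
      exact (pow_dvd_pow _ h).mul_left _
    · simp [show a ≠ 0 by omega]
  refine not_isCohenMacaulayRing_quotient (x := X 0) (y := X 3 ^ 2) (fun f hf => ?_) (by simp)
    (fun k t ht => ?_) (fun t ht => ?_) fun i => ?_
  · rw [← hcoeff ![(Polynomial.X : Polynomial K), 0, 0, 0] (by simp [Fin.forall_fin_succ]),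
      hX f hf, Polynomial.coeff_zero]
  · have := hX _ ht
    simp only [map_mul, map_pow, aeval_X, Matrix.cons_val_zero] at this
    rw [← hcoeff ![(Polynomial.X : Polynomial K), 0, 0, 0] (by simp [Fin.forall_fin_succ]),
      (mul_eq_zero.1 this).resolve_left (pow_ne_zero _ Polynomial.X_ne_zero), Polynomial.coeff_zero]
  · have := hW _ ht
    rw [Ideal.mem_span_singleton, map_mul, map_pow, aeval_X, pow_succ] at this
    rw [← hcoeff ![0, 0, 0, (Polynomial.X : Polynomial K)] (by simp [Fin.forall_fin_succ]),
      ← Polynomial.X_dvd_iff]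
    exact (mul_dvd_mul_iff_left (pow_ne_zero 2 Polynomial.X_ne_zero)).1 this
  -- The least forms of `f₂`, `f₅`, `f₁`, `f₄` supply, in this order, powers of `X 0`, …, `X 3` that
  -- kill `X 3 ^ 2`.
  · have hmem : ∀ f ∈ p.basisSet K s l, leastForm f ∈ tangentConeIdeal (toricIdeal K p.n) :=
      fun f hf => (H.isStandardBasis K hs hl fun i => H.leadsG_degLex hs hl).2.1 ⟨f, hf, rfl⟩
    obtain ⟨m1, m2, m3, m4, m5, m6, m7, mg, mh⟩ := mem_basisSet_self K (p := p) s l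
    have k1 := hmem _ m1
    have k2 := hmem _ m2
    have k4 := hmem _ m4
    have k5 := hmem _ m5
    rw [H.leastForm_f₁ K, neg_mem_iff, monomial_exponent] at k1
    rw [H.leastForm_f₂ K, neg_mem_iff, monomial_exponent] at k2
    rw [H.leastForm_f₄ K, monomial_exponent] at k4
    rw [H.leastForm_f₅ K, neg_mem_iff, monomial_exponent] at k5
    fin_cases i
    · exact ⟨p.α₂₁, by convert Ideal.mul_mem_right (X 3) _ k2 using 1; simp; ring⟩
    · exact ⟨1, by simpa using k5⟩
    · exact ⟨1, by simpa using k1⟩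
    · exact ⟨1, by simpa [← pow_succ'] using k4⟩

end Admissible

end PSParams

theorem mainTheorem2 (K : Type*) [Field K] [IsAlgClosed K] (p : PSParams)
    (hp : p.Valid) (hα₄ : p.α₄ = 3)
    (hgcd : Finset.univ.gcd p.n = 1)
    (h₁₂ : p.n 0 < p.n 1) (h₂₃ : p.n 1 < p.n 2) (h₃₄ : p.n 2 < p.n 3)
    (hα₂ : p.α₂₁ + 1 < p.α₂)
    (s l : ℕ) (hs : p.IsS s) (hl : p.IsL l) :
    -- the least homogeneous forms of the elements of `G`
    (leastForm (p.f₁ K) = -(X 2 * X 3 ^ 2) ∧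
      leastForm (p.f₂ K) = -(X 0 ^ p.α₂₁ * X 3) ∧
      leastForm (p.f₃ K) = X 2 ^ p.α₃ ∧
      leastForm (p.f₄ K) = X 3 ^ 3 ∧
      leastForm (p.f₅ K) = -(X 1 * X 3 ^ 2) ∧
      leastForm (p.f₆ K) = -(X 1 ^ p.α₂ * X 2 * X 3) ∧
      leastForm (p.f₇ K) = -(X 1 ^ (2 * p.α₂) * X 2) ∧
      (∀ i < s,
        (i * p.α₁ + (2 * i + 2) * p.α₂₁ + p.α₃ < (2 * i + 1) * p.α₂ + (i + 2) →
          leastForm (p.g K i) =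
            -(X 0 ^ (i * p.α₁ + (2 * i + 2) * p.α₂₁ + 1) * X 2 ^ (p.α₃ - (i + 1)))) ∧
        (i * p.α₁ + (2 * i + 2) * p.α₂₁ + p.α₃ = (2 * i + 1) * p.α₂ + (i + 2) →
          leastForm (p.g K i) = p.g K i)) ∧
      leastForm (p.g K s) = X 1 ^ ((2 * s + 1) * p.α₂ + 1) * X 3 ∧
      (∀ j, s ≤ j → j < l →
        (j * p.α₁ + (2 * j + 3) * p.α₂₁ + p.α₃ < (2 * j + 2) * p.α₂ + (j + 1) →
          leastForm (p.h K j) =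
            -(X 0 ^ (j * p.α₁ + (2 * j + 3) * p.α₂₁ + 1) * X 2 ^ (p.α₃ - (j + 1)))) ∧
        (j * p.α₁ + (2 * j + 3) * p.α₂₁ + p.α₃ = (2 * j + 2) * p.α₂ + (j + 1) →
          leastForm (p.h K j) = p.h K j)) ∧
      leastForm (p.h K l) = X 1 ^ ((2 * l + 2) * p.α₂ + 1)) ∧
    -- they generate `I_S^*` and form a standard basis of it
    (tangentConeIdeal (toricIdeal K p.n) = Ideal.span (leastForm '' p.basisSet K s l) ∧
      ∀ o : LocalDegreeOrder 4, (∀ i < s, p.LeadsG o i) →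
        o.IsStandardBasis (leastForm '' p.basisSet K s l)
          (tangentConeIdeal (toricIdeal K p.n))) ∧
    -- `X_1` divides `f₂^*`, and the tangent cone is not Cohen–Macaulay
    (X 0 ∣ leastForm (p.f₂ K) ∧
      ¬ IsCohenMacaulayRing
        (MvPolynomial (Fin 4) K ⧸ tangentConeIdeal (toricIdeal K p.n))) := by
  have H : p.Admissible := ⟨hp, hα₄, hgcd, h₁₂, h₂₃, h₃₄, hα₂⟩
  have hsl := H.s_le_l hs hl
  have hlc := H.l_lt_α₃ hl
  refine ⟨⟨?_, ?_, ?_, ?_, ?_, ?_, ?_, fun i hi => ⟨fun h => ?_, fun h => ?_⟩, ?_,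
      fun j hj hjl => ⟨fun h => ?_, fun h => ?_⟩, ?_⟩,
    ⟨H.tangentConeIdeal_eq K hs hl, fun o ho => H.isStandardBasis K hs hl ho⟩, ?_,
    H.not_isCohenMacaulayRing K hs hl⟩
  · simp [H.leastForm_f₁ K, monomial_exponent]
  · simp [H.leastForm_f₂ K, monomial_exponent]
  · simp [H.leastForm_f₃ K, monomial_exponent]
  · simp [H.leastForm_f₄ K, monomial_exponent]
  · simp [H.leastForm_f₅ K, monomial_exponent]
  · simp [H.leastForm_f₆ K, monomial_exponent]
  · simp [H.leastForm_f₇ K, monomial_exponent]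
  · simp [PSParams.leastForm_g_of_lt K (by omega) h, monomial_exponent]
  · exact PSParams.leastForm_g_of_eq K (by omega) h
  · simp [H.leastForm_g_last K hs hl, monomial_exponent]
  · simp [PSParams.leastForm_h_of_lt K (by omega) h, monomial_exponent]
  · exact PSParams.leastForm_h_of_eq K (by omega) h
  · simp [H.leastForm_h_last K hl, monomial_exponent]
  · rw [H.leastForm_f₂ K, dvd_neg, monomial_exponent, pow_zero, pow_zero, mul_one, mul_one]
    exact (dvd_pow_self _ hp.2.2.2.2.1.ne').mul_right _
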